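/- Let $d_{\rm in},d,d_{\rm out},k\ge 1$ and $T\ge 0$ be integers, and let $\lambda,\kappa>0$ ($\kappa=2$ being He initialization). Write $|\cdot|$ for the Euclidean norm and $\|\cdot\|_F$ for the Frobenius norm. Let $\rho$ be a probability measure on $\mathbb R^{d_{\rm in}}\times\mathbb R^{d_{\rm out}}$ whose support is contained in $\{(x,y):\max(|x|,|y|)\le 1\}$. Let $l:\mathbb R^{d_{\rm out}}\times\mathbb R^{d_{\rm out}}\to\mathbb R$ be $\mathcal C^1$, $1$-Lipschitz in the sense that $|l(a,b)-l(a',b')|\le|a-a'|+|b-b'|$, with $l(y,y)=0$ for $|y|\le 1$. Let $\sigma:\mathbb R\to\mathbb R$ be $\mathcal C^1$ and $1$-Lipschitz with $\sigma(0)=0$. For $v\in\mathbb R^{d_{\rm in}\times d}$, $w\in\mathbb R^{d\times d_{\rm out}}$ put $f(x,v,w)=w^\top\sigma(v^\top x)$ (with $\sigma$ applied componentwise) and $$\ell_\lambda(a,y,v,w)=l(a,y)+\tfrac{\lambda}{2}\big(\|v\|_F^2+\|w\|_F^2\big).$$ At each time $0\le t<T$ let $Z^{(t)}=(X^{(t)}_i,Y^{(t)}_i)_{1\le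 i\le k}$ be independent samples with law $\rho$, and let $\mathcal L_k(Z^{(t)},v,w)=\frac1k\sum_{i=1}^k\ell_\lambda\big(f(X^{(t)}_i,v,w),Y^{(t)}_i,v,w\big)$. The stochastic gradient method is $$V(t+1)=V(t)-\eta_V(t)\nabla_v\mathcal L_k(Z^{(t)},V(t),W(t)),\qquad W(t+1)=W(t)-\eta_W(t)\nabla_w\mathcal L_k(Z^{(t)},V(t),W(t)),$$ where $0\le\eta_W(t)\le\eta_V(t)\le 1/\lambda$ for $0\le t<T$. The entries of $V(0)$ are independent centered Gaussian variables with variance $\kappa/d$. Let $$S(v,w)=\sup_{(x,y)\in{\rm Supp}(\rho)}\big|\nabla_x\,\ell_\lambda(f(x,v,w),y,v,w)\big|.$$ (a) Suppose that $\eta_W(t)=0$ for $0\le t<T$, so that $W(t)=w$ stays frozen at $w=W(0)\in\mathbb R^{d\times d_{\rm out}}$, where $w$ is a fixed matrix or, more generally, any random matrix. Write $\eta=\eta_V$. Then for every $\zeta\in(0,1)$, with probability at least $1-\zeta$, $$S(V(T),w)\le\|w\|_F\Big(\sqrt{d_{\rm in}}+\sqrt d+\sqrt{2\log\tfrac2\zeta}\Big)\sqrt{\tfrac{\kappa}{d}}\prod_{t=0}^{T-1}(1-\eta(t)\lambda)+\frac{\|w\|_F^2}{\lambda}\Big(1-\prod_{t=0}^{T-1}(1-\eta(t)\lambda)\Big).$$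 (b) Suppose that $\eta_W(t)=\eta_V(t)=:\eta(t)$ for $0\le t<T$, that the entries of $W(0)$ are centered Gaussian variables with variance $\kappa/d_{\rm out}$, and that all the entries of $V(0)$ and $W(0)$ together are independent. Then for every $\zeta\in(0,1)$, with probability at least $1-\zeta$, $$S(V(T),W(T))\le 3\kappa\Big(2+\frac{d_{\rm in}}{d}+\frac{d}{d_{\rm out}}+\Big(\frac2d+\frac2{d_{\rm out}}\Big)\log\frac4\zeta\Big)\prod_{t=0}^{T-1}\big(1+(1-\lambda)\eta(t)\big)^2.$$ -/

import Mathlib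

open MeasureTheory ProbabilityTheory
open scoped Matrix

noncomputable section

namespace TwoLayer

/-- The Euclidean space `ℝⁿ` with its Euclidean norm. -/
abbrev Vec (n : ℕ) : Type := EuclideanSpace ℝ (Fin n)

/-- The space of real `m × n` matrices. -/
abbrev Mat (m n : ℕ) : Type := Matrix (Fin m) (Fin n) ℝ

/-- The Frobenius norm of a matrix. -/
def frobNorm {m n : ℕ} (v : Mat m n) : ℝ :=
  Real.sqrt (∑ i, ∑ j, |v i j| ^ 2)

/-- The matrix gradient of a real function of a matrix: its `(i, j)` entry is the partial
derivative with respect to the `(i, j)` entry of the argument. -/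
def matGrad {m n : ℕ} (F : Mat m n → ℝ) (v : Mat m n) : Mat m n :=
  Matrix.of fun i j => lineDeriv ℝ F v (Matrix.single i j 1)

/-- The two-layer network `f(x, v, w) = wᵀ σ(vᵀ x)`, with `σ` applied componentwise. -/
def network {din d dout : ℕ} (σ : ℝ → ℝ) (x : Vec din) (v : Mat din d) (w : Mat d dout) :
    Vec dout :=
  WithLp.toLp 2 (wᵀ *ᵥ (fun j => σ ((vᵀ *ᵥ x.ofLp) j)))

/-- The regularized loss `ℓ_lam(a, y, v, w) = l(a, y) + (lam / 2) (‖v‖_F² + ‖w‖_F²)`. -/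
def regLoss {din d dout : ℕ} (l : Vec dout → Vec dout → ℝ) (lam : ℝ)
    (a y : Vec dout) (v : Mat din d) (w : Mat d dout) : ℝ :=
  l a y + lam / 2 * (frobNorm v ^ 2 + frobNorm w ^ 2)

/-- The average regularized loss of the network over a batch `z` of `k` samples. -/
def batchLoss {din d dout k : ℕ} (l : Vec dout → Vec dout → ℝ) (σ : ℝ → ℝ) (lam : ℝ)
    (z : Fin k → Vec din × Vec dout) (v : Mat din d) (w : Mat d dout) : ℝ :=
  1 / (k : ℝ) * ∑ i, regLoss l lam (network σ (z i).1 v w) (z i).2 v w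

/-- The stochastic gradient iteration `t ↦ (V(t), W(t))` started at `(v₀, w₀)`, with learning
rates `ηV`, `ηW`, where step `t` uses the batch `z t`. -/
def sgm {din d dout k : ℕ} (l : Vec dout → Vec dout → ℝ) (σ : ℝ → ℝ) (lam : ℝ)
    (ηV ηW : ℕ → ℝ) (z : ℕ → Fin k → Vec din × Vec dout) (v₀ : Mat din d) (w₀ : Mat d dout) :
    ℕ → Mat din d × Mat d dout
  | 0 => (v₀, w₀)
  | t + 1 =>
    let V := (sgm l σ lam ηV ηW z v₀ w₀ t).1
    let W := (sgm l σ lam ηV ηW z v₀ w₀ t).2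
    (V - ηV t • matGrad (fun v => batchLoss l σ lam (z t) v W) V,
      W - ηW t • matGrad (fun w => batchLoss l σ lam (z t) V w) W)

/-- The supremum over `(x, y)` in the support of `ρ` of the Euclidean norm of the gradient
in `x` of `ℓ_lam(f(x, v, w), y, v, w)`, as an extended nonnegative number. -/
def supGrad {din d dout : ℕ} (ρ : Measure (Vec din × Vec dout))
    (l : Vec dout → Vec dout → ℝ) (σ : ℝ → ℝ) (lam : ℝ)
    (v : Mat din d) (w : Mat d dout) : ENNReal :=
  ⨆ z ∈ ρ.support,
    ENNReal.ofReal ‖gradient (fun x => regLoss l lam (network σ x v w) z.2 v w) z.1‖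

/-- The assumptions on the data distribution, the loss and the activation function. -/
structure Setting {din dout : ℕ} (ρ : Measure (Vec din × Vec dout))
    (l : Vec dout → Vec dout → ℝ) (σ : ℝ → ℝ) : Prop where
  support_subset : ρ.support ⊆ {z | max ‖z.1‖ ‖z.2‖ ≤ 1}
  loss_contDiff : ContDiff ℝ 1 (fun p : Vec dout × Vec dout => l p.1 p.2)
  /-- This is equivalent to being `1`-Lipschitz in each of the two arguments. -/
  loss_lipschitz : ∀ a a' b b' : Vec dout, |l a b - l a' b'| ≤ ‖a - a'‖ + ‖b - b'‖
  loss_diag : ∀ y : Vec dout, ‖y‖ ≤ 1 → l y y = 0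
  act_contDiff : ContDiff ℝ 1 σ
  act_lipschitz : LipschitzWith 1 σ
  act_zero : σ 0 = 0

/-- Every entry of the random matrix `M` is a centered Gaussian variable of variance `s`. -/
def GaussianEntries {Ω : Type*} [MeasurableSpace Ω] (μ : Measure Ω) {m n : ℕ}
    (M : Ω → Mat m n) (s : ℝ) : Prop :=
  ∀ i j, HasLaw (fun ω => M ω i j) (gaussianReal 0 s.toNNReal) μ

/-- The entries of the random matrix `M`, as a family of random variables. -/
def entries {Ω : Type*} {m n : ℕ} (M : Ω → Mat m n) (p : Fin m × Fin n) (ω : Ω) : ℝ :=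
  M ω p.1 p.2

end TwoLayer

end

/-! Both bounds reduce to operator norms at initialization. The gradient in `x` of the loss is at
most `‖v‖ ‖w‖`. The data loss is `‖w‖`-Lipschitz in `v` and `‖v‖`-Lipschitz in `w` for the operator
norm, since inputs almost surely have norm at most 1. With weight decay, a step in `v` therefore
gives `‖V(t+1)‖ ≤ (1 - ηλ)‖V(t)‖ + η‖W(t)‖`, and symmetrically for `w`. This recursion is solved for
a frozen `w` in `Setting.norm_sgm_fst_le`, and for the sum of the two norms in
`Setting.norm_sgm_add_norm_sgm_le`.

The probabilistic input is `measure_l2_opNorm_gt_le`: a standard Gaussian `m × n` matrix `G` has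
norm above `√m + √n + t` with probability at most `exp (-t²/2)`. Instead of combining a bound on the
mean with concentration, the proof compares exponential moments. For unit vectors, `uᵀGv + ξ` with
`ξ` an independent standard Gaussian has the same variance as `⟨u,g⟩ + ⟨v,h⟩` and larger or equal
covariances. So `exp (θ²/2) E exp (θ max uᵀGv) ≤ E exp (θ (|g| + |h|)) ≤ exp (θ(√m + √n) + θ²)`,
first over finite families (`integral_smoothExpMax_comparison`), and Markov's inequality at `θ = t`
concludes. -/

namespace TwoLayer

/-! ### Gaussian integration by parts. -/

section Gaussian

variable {J : Type*} [Fintype J]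

/-- The standard Gaussian measure on `J → ℝ`. -/
noncomputable abbrev stdPi (J : Type*) [Fintype J] : Measure (J → ℝ) :=
  Measure.pi fun _ => gaussianReal 0 1

/-- The density of the standard Gaussian measure on `J → ℝ`. -/
noncomputable def stdDensity (x : J → ℝ) : ℝ := ∏ j, gaussianPDFReal 0 1 (x j)

lemma stdDensity_nonneg (x : J → ℝ) : 0 ≤ stdDensity x :=
  Finset.prod_nonneg fun _ _ => gaussianPDFReal_nonneg _ _ _

lemma measurable_stdDensity : Measurable (stdDensity : (J → ℝ) → ℝ) :=
  Finset.measurable_prod _ fun j _ =>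
    (measurable_gaussianPDFReal 0 1).comp (measurable_pi_apply j)

lemma integrable_stdDensity : Integrable (stdDensity : (J → ℝ) → ℝ) :=
  Integrable.fintype_prod fun _ => integrable_gaussianPDFReal 0 1

lemma stdPi_eq_withDensity :
    stdPi J = volume.withDensity fun x => ENNReal.ofReal (stdDensity x) := by
  refine (Measure.pi_eq fun s hs => ?_)
  rw [withDensity_apply _ (MeasurableSet.univ_pi hs),
    ← ofReal_integral_eq_lintegral_ofReal integrable_stdDensity.restrict
      (ae_of_all _ stdDensity_nonneg), volume_pi, Measure.restrict_pi_pi]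
  simp only [stdDensity]
  rw [integral_fintype_prod_eq_prod (fun _ : J => gaussianPDFReal 0 1),
    ENNReal.ofReal_prod_of_nonneg]
  · simp_rw [gaussianReal_apply_eq_integral 0 one_ne_zero]
  · exact fun i _ => integral_nonneg (gaussianPDFReal_nonneg _ _)

lemma integral_stdPi (f : (J → ℝ) → ℝ) : ∫ x, f x ∂stdPi J = ∫ x, stdDensity x * f x := by
  rw [stdPi_eq_withDensity, integral_withDensity_eq_integral_toReal_smul
    measurable_stdDensity.ennreal_ofReal (ae_of_all _ fun _ => ENNReal.ofReal_lt_top)]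
  simp [ENNReal.toReal_ofReal, stdDensity_nonneg]

lemma integrable_stdPi_iff (f : (J → ℝ) → ℝ) :
    Integrable f (stdPi J) ↔ Integrable fun x => stdDensity x * f x := by
  rw [stdPi_eq_withDensity, integrable_withDensity_iff_integrable_smul'
    measurable_stdDensity.ennreal_ofReal (ae_of_all _ fun _ => ENNReal.ofReal_lt_top)]
  simp [ENNReal.toReal_ofReal, stdDensity_nonneg]

lemma stdDensity_eq (x : J → ℝ) :
    stdDensity x = (√(2 * Real.pi))⁻¹ ^ Fintype.card J * Real.exp (-∑ j, x j ^ 2 / 2) := by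
  simp [stdDensity, gaussianPDFReal, Finset.prod_mul_distrib, ← Real.exp_sum, neg_div,
    Finset.sum_neg_distrib]

/-- Moving a derivative along `c` onto the density produces the linear factor `c ⬝ᵥ x` of the
integration by parts formula. -/
lemma hasLineDerivAt_stdDensity (x c : J → ℝ) :
    HasLineDerivAt ℝ stdDensity (-((c ⬝ᵥ x) * stdDensity x)) x c := by
  unfold HasLineDerivAt
  simp only [stdDensity_eq]
  have h1 : HasDerivAt (fun t : ℝ => -∑ j, (x + t • c) j ^ 2 / 2) (-(c ⬝ᵥ x)) 0 := by
    refine (HasDerivAt.fun_sum fun j _ => ?_).neg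
    have h2 : HasDerivAt (fun t : ℝ => x j + t * c j) (c j) 0 := by
      simpa using ((hasDerivAt_id (0 : ℝ)).mul_const (c j)).const_add (x j)
    have := (h2.pow 2).div_const 2
    simp only [Pi.add_apply, Pi.smul_apply, smul_eq_mul]
    convert! this using 1
    simp
    ring
  have h3 := (h1.exp).const_mul ((√(2 * Real.pi))⁻¹ ^ Fintype.card J)
  convert! h3 using 1
  simp
  ring

/-- Gaussian integration by parts. -/
lemma integral_dotProduct_mul_stdPi {c : J → ℝ} {G G' : (J → ℝ) → ℝ}
    (hG : ∀ x, HasLineDerivAt ℝ G (G' x) x c) (h₀ : Integrable G (stdPi J))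
    (h₁ : Integrable G' (stdPi J)) (h₂ : Integrable (fun x => (c ⬝ᵥ x) * G x) (stdPi J)) :
    ∫ x, (c ⬝ᵥ x) * G x ∂stdPi J = ∫ x, G' x ∂stdPi J := by
  rw [integrable_stdPi_iff] at h₀ h₁ h₂
  rw [integral_stdPi, integral_stdPi]
  have := integral_bilinear_hasLineDerivAt_right_eq_neg_left_of_integrable
    (μ := (volume : Measure (J → ℝ))) (f := G) (f' := G') (g := stdDensity)
    (g' := fun x => -((c ⬝ᵥ x) * stdDensity x)) (v := c) (B := ContinuousLinearMap.mul ℝ ℝ)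
    (by simpa [mul_comm] using h₁)
    (by convert! h₂.neg using 2; simp; ring) (by simpa [mul_comm] using h₀)
    (fun x _ => hG x) (fun x _ => hasLineDerivAt_stdDensity x c)
  simp only [ContinuousLinearMap.mul_apply', mul_neg, integral_neg, neg_inj] at this
  calc _ = _ := by congr 1; ext x; ring
    _ = _ := this
    _ = _ := by congr 1; ext x; ring

/-- The `ℓ¹` norm. -/
def absSum (x : J → ℝ) : ℝ := ∑ j, |x j|

lemma abs_dotProduct_le {a : J → ℝ} {M : ℝ} (ha : ∀ j, |a j| ≤ M) (x : J → ℝ) :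
    |a ⬝ᵥ x| ≤ M * absSum x := by
  rw [absSum, Finset.mul_sum]
  refine (Finset.abs_sum_le_sum_abs _ _).trans (Finset.sum_le_sum fun j _ => ?_)
  rw [abs_mul]
  exact mul_le_mul_of_nonneg_right (ha j) (abs_nonneg _)

/-- The common dominating function for the comparison argument. It factors over coordinates, and
`exp (K|x|) ≤ exp (Kx) + exp (-Kx)` in each. -/
lemma integrable_exp_mul_absSum (K : ℝ) :
    Integrable (fun x => Real.exp (K * absSum x)) (stdPi J) := by
  have h1 : Integrable (fun x : ℝ => Real.exp (K * |x|)) (gaussianReal 0 1) := by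
    refine ((integrable_exp_mul_gaussianReal K).add (integrable_exp_mul_gaussianReal (-K))).mono'
      (by fun_prop) (ae_of_all _ fun x => ?_)
    simp only [Real.norm_eq_abs, Real.abs_exp, Pi.add_apply]
    rcases abs_cases x with ⟨h, _⟩ | ⟨h, _⟩ <;> rw [h]
    · exact le_add_of_nonneg_right (Real.exp_nonneg _)
    · rw [neg_mul, mul_neg]
      exact le_add_of_nonneg_left (Real.exp_nonneg _)
  have := Integrable.fintype_prod (ι := J) (μ := fun _ => gaussianReal 0 1) fun _ => h1
  simpa only [absSum, ← Real.exp_sum, ← Finset.mul_sum] using this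

lemma integrable_of_le_exp_absSum {f : (J → ℝ) → ℝ} (hf : Continuous f) (C K : ℝ)
    (h : ∀ x, |f x| ≤ C * Real.exp (K * absSum x)) : Integrable f (stdPi J) :=
  ((integrable_exp_mul_absSum K).const_mul C).mono' hf.aestronglyMeasurable (ae_of_all _ h)

end Gaussian

/-! ### Log-sum-exp and its gradient, the softmax. -/

section LogSumExp

variable {ι : Type*} [Fintype ι]

/-- The function `z ↦ log ∑ᵢ exp (β zᵢ)`. -/
noncomputable def logSumExp (β : ℝ) (z : ι → ℝ) : ℝ := Real.log (∑ i, Real.exp (β * z i))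

/-- The softmax weights `exp (β zᵢ) / ∑ⱼ exp (β zⱼ)`. -/
noncomputable def softmax (β : ℝ) (z : ι → ℝ) (i : ι) : ℝ := Real.exp (β * z i - logSumExp β z)

lemma softmax_nonneg (β : ℝ) (z : ι → ℝ) (i : ι) : 0 ≤ softmax β z i := Real.exp_nonneg _

variable [Nonempty ι]

lemma sum_exp_pos (β : ℝ) (z : ι → ℝ) : 0 < ∑ i, Real.exp (β * z i) :=
  Finset.sum_pos (fun _ _ => Real.exp_pos _) Finset.univ_nonempty

lemma softmax_eq (β : ℝ) (z : ι → ℝ) (i : ι) :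
    softmax β z i = Real.exp (β * z i) / ∑ j, Real.exp (β * z j) := by
  rw [softmax, Real.exp_sub, logSumExp, Real.exp_log (sum_exp_pos β z)]

lemma sum_softmax (β : ℝ) (z : ι → ℝ) : ∑ i, softmax β z i = 1 := by
  simp_rw [softmax_eq, ← Finset.sum_div, div_self (sum_exp_pos β z).ne']

lemma softmax_le_one (β : ℝ) (z : ι → ℝ) (i : ι) : softmax β z i ≤ 1 :=
  (sum_softmax β z).symm ▸
    Finset.single_le_sum (fun j _ => softmax_nonneg β z j) (Finset.mem_univ i)

lemma mul_le_logSumExp (β : ℝ) (z : ι → ℝ) (i : ι) : β * z i ≤ logSumExp β z := by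
  have := softmax_le_one β z i
  rwa [softmax, Real.exp_le_one_iff, sub_nonpos] at this

lemma logSumExp_le {β : ℝ} (hβ : 0 ≤ β) {z : ι → ℝ} {M : ℝ} (h : ∀ i, z i ≤ M) :
    logSumExp β z ≤ Real.log (Fintype.card ι) + β * M := by
  have hc : (0 : ℝ) < Fintype.card ι := by exact_mod_cast Fintype.card_pos
  rw [logSumExp, Real.log_le_iff_le_exp (sum_exp_pos β z), Real.exp_add, Real.exp_log hc]
  refine (Finset.sum_le_card_nsmul _ _ (Real.exp (β * M)) fun i _ => ?_).trans (by simp)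
  exact Real.exp_le_exp.2 (mul_le_mul_of_nonneg_left (h i) hβ)

lemma hasDerivAt_logSumExp {β : ℝ} {z : ℝ → ι → ℝ} {z' : ι → ℝ} {t : ℝ}
    (h : ∀ i, HasDerivAt (fun s => z s i) (z' i) t) :
    HasDerivAt (fun s => logSumExp β (z s)) (β * ∑ i, softmax β (z t) i * z' i) t := by
  have := (HasDerivAt.fun_sum (u := Finset.univ)
    fun i _ => ((h i).const_mul β).exp).log (sum_exp_pos β (z t)).ne'
  convert! this using 1
  simp_rw [softmax_eq, Finset.mul_sum, Finset.sum_div]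
  exact Finset.sum_congr rfl fun i _ => by ring

lemma continuous_logSumExp (β : ℝ) : Continuous (logSumExp β : (ι → ℝ) → ℝ) :=
  Continuous.log (by fun_prop) fun z => (sum_exp_pos β z).ne'

lemma continuous_softmax (β : ℝ) (i : ι) : Continuous fun z : ι → ℝ => softmax β z i :=
  Real.continuous_exp.comp
    ((continuous_const.mul (continuous_apply i)).sub (continuous_logSumExp β))

end LogSumExp

/-! ### Smoothed exponential maxima of Gaussian linear forms. -/

section Comparison

variable {ι J : Type*} [Fintype J]

/-- The linear functionals with coefficients `e`. -/
def linForms (e : ι → J → ℝ) (x : J → ℝ) (i : ι) : ℝ := e i ⬝ᵥ x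

lemma continuous_linForms (e : ι → J → ℝ) : Continuous (linForms e) := by
  unfold linForms
  fun_prop

lemma hasDerivAt_linForms (e : ι → J → ℝ) (x v : J → ℝ) (i : ι) :
    HasDerivAt (fun t : ℝ => linForms e (x + t • v) i) (e i ⬝ᵥ v) 0 := by
  simp only [linForms, dotProduct_add, dotProduct_smul, smul_eq_mul]
  simpa using ((hasDerivAt_id (0 : ℝ)).mul_const (e i ⬝ᵥ v)).const_add (e i ⬝ᵥ x)

variable [Fintype ι]

/-- The smoothed version `(∑ᵢ exp (β zᵢ)) ^ (θ / β)` of `exp (θ maxᵢ zᵢ)`. -/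
noncomputable def smoothExpMax (θ β : ℝ) (z : ι → ℝ) : ℝ := Real.exp (θ / β * logSumExp β z)

lemma smoothExpMax_nonneg (θ β : ℝ) (z : ι → ℝ) : 0 ≤ smoothExpMax θ β z := Real.exp_nonneg _

variable [Nonempty ι]

lemma continuous_smoothExpMax (θ β : ℝ) : Continuous (smoothExpMax θ β : (ι → ℝ) → ℝ) :=
  Real.continuous_exp.comp (continuous_const.mul (continuous_logSumExp β))

lemma exp_mul_le_smoothExpMax {θ β : ℝ} (hθ : 0 ≤ θ) (hβ : 0 < β) (z : ι → ℝ) (i : ι) :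
    Real.exp (θ * z i) ≤ smoothExpMax θ β z := by
  refine Real.exp_le_exp.2 ?_
  have := mul_le_mul_of_nonneg_left (mul_le_logSumExp β z i) (div_nonneg hθ hβ.le)
  rwa [← mul_assoc, div_mul_cancel₀ _ hβ.ne'] at this

/-- Smoothing costs only the factor `card ι ^ (θ / β)`, which tends to 1 as `β → ∞`. -/
lemma smoothExpMax_le {θ β : ℝ} (hθ : 0 ≤ θ) (hβ : 0 < β) {z : ι → ℝ} {M : ℝ}
    (h : ∀ i, z i ≤ M) :
    smoothExpMax θ β z ≤ Real.exp (θ / β * Real.log (Fintype.card ι)) * Real.exp (θ * M) := by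
  rw [← Real.exp_add]
  refine Real.exp_le_exp.2 ?_
  have := mul_le_mul_of_nonneg_left (logSumExp_le hβ.le h) (div_nonneg hθ hβ.le)
  rwa [mul_add, ← mul_assoc _ β, div_mul_cancel₀ _ hβ.ne'] at this

lemma hasDerivAt_smoothExpMax {θ β : ℝ} (hβ : β ≠ 0) {z : ℝ → ι → ℝ} {z' : ι → ℝ} {t : ℝ}
    (h : ∀ i, HasDerivAt (fun s => z s i) (z' i) t) :
    HasDerivAt (fun s => smoothExpMax θ β (z s))
      (θ * smoothExpMax θ β (z t) * ∑ i, softmax β (z t) i * z' i) t := by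
  have := ((hasDerivAt_logSumExp (β := β) h).const_mul (θ / β)).exp
  convert! this using 1
  simp only [smoothExpMax]
  field_simp

/-- The product is the single exponential `exp (β zᵢ + (θ/β - 1) logSumExp β z)`, whence the
coefficient `θ - β`. -/
lemma hasDerivAt_softmax_mul_smoothExpMax {θ β : ℝ} (hβ : β ≠ 0) {z : ℝ → ι → ℝ} {z' : ι → ℝ}
    {t : ℝ} (h : ∀ i, HasDerivAt (fun s => z s i) (z' i) t) (i : ι) :
    HasDerivAt (fun s => softmax β (z s) i * smoothExpMax θ β (z s))
      (softmax β (z t) i * smoothExpMax θ β (z t) *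
        (β * z' i + (θ - β) * ∑ j, softmax β (z t) j * z' j)) t := by
  have h1 := (((h i).const_mul β).sub (hasDerivAt_logSumExp (β := β) h)).exp
  have h2 := h1.mul (hasDerivAt_smoothExpMax (θ := θ) hβ h)
  convert! h2 using 1
  simp only [softmax, Pi.sub_apply]
  ring

variable {θ β M : ℝ} {e c : ι → J → ℝ}

lemma smoothExpMax_linForms_le (hθ : 0 ≤ θ) (hβ : 0 < β) (he : ∀ i j, |e i j| ≤ M) (x : J → ℝ) :
    smoothExpMax θ β (linForms e x) ≤
      Real.exp (θ / β * Real.log (Fintype.card ι)) * Real.exp (θ * M * absSum x) := by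
  rw [mul_assoc θ]
  exact smoothExpMax_le hθ hβ fun i => (le_abs_self _).trans (abs_dotProduct_le (he i) x)

/-- The bound depends on `e` and `c` only through `M`, so it can dominate along a whole path of
coefficients. The extra 1 in the exponent absorbs the linear factor. -/
lemma abs_linForms_mul_softmax_mul_le (hθ : 0 ≤ θ) (hβ : 0 < β) (hM : 0 ≤ M)
    (he : ∀ i j, |e i j| ≤ M) (hc : ∀ i j, |c i j| ≤ M) (x : J → ℝ) (i : ι) :
    |(c i ⬝ᵥ x) * (softmax β (linForms e x) i * smoothExpMax θ β (linForms e x))| ≤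
      M * Real.exp (θ / β * Real.log (Fintype.card ι)) *
        Real.exp ((θ * M + 1) * absSum x) := by
  have h1 := abs_dotProduct_le (hc i) x
  have h2 := smoothExpMax_linForms_le hθ hβ he x
  have h3 : absSum x ≤ Real.exp (absSum x) := (lt_add_one _).le.trans (Real.add_one_le_exp _)
  rw [abs_mul, abs_of_nonneg (a := _ * smoothExpMax _ _ _)
    (mul_nonneg (softmax_nonneg _ _ _) (smoothExpMax_nonneg _ _ _)), add_mul, one_mul, Real.exp_add]
  have h4 : softmax β (linForms e x) i * smoothExpMax θ β (linForms e x) ≤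
      Real.exp (θ / β * Real.log (Fintype.card ι)) * Real.exp (θ * M * absSum x) :=
    (mul_le_of_le_one_left (smoothExpMax_nonneg _ _ _) (softmax_le_one _ _ _)).trans h2
  calc _ ≤ (M * Real.exp (absSum x)) * (Real.exp (θ / β * Real.log (Fintype.card ι)) *
        Real.exp (θ * M * absSum x)) :=
        mul_le_mul (h1.trans (mul_le_mul_of_nonneg_left h3 hM)) h4
          (mul_nonneg (softmax_nonneg _ _ _) (smoothExpMax_nonneg _ _ _)) (by positivity)
    _ = _ := by ring

lemma integrable_smoothExpMax_linForms (hθ : 0 ≤ θ) (hβ : 0 < β) (he : ∀ i j, |e i j| ≤ M) :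
    Integrable (fun x => smoothExpMax θ β (linForms e x)) (stdPi J) :=
  integrable_of_le_exp_absSum ((continuous_smoothExpMax θ β).comp (continuous_linForms e)) _ _
    fun x => (abs_of_nonneg (smoothExpMax_nonneg _ _ _)).le.trans
      (smoothExpMax_linForms_le hθ hβ he x)

lemma integrable_bdd_mul_smoothExpMax (hθ : 0 ≤ θ) (hβ : 0 < β) (he : ∀ i j, |e i j| ≤ M)
    {f : (J → ℝ) → ℝ} (hf : Continuous f) {C : ℝ} (hC : ∀ x, |f x| ≤ C) :
    Integrable (fun x => f x * smoothExpMax θ β (linForms e x)) (stdPi J) :=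
  (integrable_smoothExpMax_linForms hθ hβ he).bdd_mul hf.aestronglyMeasurable
    (ae_of_all _ hC)

lemma continuous_softmax_linForms (e : ι → J → ℝ) (i : ι) :
    Continuous fun x => softmax β (linForms e x) i :=
  (continuous_softmax β i).comp (continuous_linForms e)

lemma integrable_linForms_mul_softmax_mul (hθ : 0 ≤ θ) (hβ : 0 < β) (hM : 0 ≤ M)
    (he : ∀ i j, |e i j| ≤ M) (hc : ∀ i j, |c i j| ≤ M) (i : ι) :
    Integrable (fun x => (c i ⬝ᵥ x) *
      (softmax β (linForms e x) i * smoothExpMax θ β (linForms e x))) (stdPi J) :=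
  integrable_of_le_exp_absSum ((by fun_prop : Continuous fun x => c i ⬝ᵥ x).mul
    ((continuous_softmax_linForms e i).mul
      ((continuous_smoothExpMax θ β).comp (continuous_linForms e)))) _ _
    fun x => abs_linForms_mul_softmax_mul_le hθ hβ hM he hc x i

lemma integral_linForms_mul_softmax_mul (hθ : 0 ≤ θ) (hβ : 0 < β) (hM : 0 ≤ M)
    (he : ∀ i j, |e i j| ≤ M) (hc : ∀ i j, |c i j| ≤ M) (i : ι) :
    ∫ x, (c i ⬝ᵥ x) * (softmax β (linForms e x) i * smoothExpMax θ β (linForms e x)) ∂stdPi J =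
      ∫ x, (softmax β (linForms e x) i *
        (β * (e i ⬝ᵥ c i) + (θ - β) * ∑ j, softmax β (linForms e x) j * (e j ⬝ᵥ c i))) *
          smoothExpMax θ β (linForms e x) ∂stdPi J ∧
    Integrable (fun x => (softmax β (linForms e x) i *
        (β * (e i ⬝ᵥ c i) + (θ - β) * ∑ j, softmax β (linForms e x) j * (e j ⬝ᵥ c i))) *
          smoothExpMax θ β (linForms e x)) (stdPi J) := by
  have hint : Integrable (fun x => (softmax β (linForms e x) i *
        (β * (e i ⬝ᵥ c i) + (θ - β) * ∑ j, softmax β (linForms e x) j * (e j ⬝ᵥ c i))) *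
          smoothExpMax θ β (linForms e x)) (stdPi J) := by
    refine integrable_bdd_mul_smoothExpMax hθ hβ he
      (C := |β * (e i ⬝ᵥ c i)| + |θ - β| * ∑ j, |e j ⬝ᵥ c i|) ?_ fun x => ?_
    · exact (continuous_softmax_linForms e i).mul (continuous_const.add (continuous_const.mul
        (continuous_finsetSum _ fun j _ => (continuous_softmax_linForms e j).mul
          continuous_const)))
    · rw [abs_mul, abs_of_nonneg (softmax_nonneg _ _ _)]
      refine (mul_le_of_le_one_left (abs_nonneg _) (softmax_le_one _ _ _)).trans
        ((abs_add_le _ _).trans (add_le_add le_rfl ?_))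
      rw [abs_mul]
      refine mul_le_mul_of_nonneg_left ((Finset.abs_sum_le_sum_abs _ _).trans
        (Finset.sum_le_sum fun j _ => ?_)) (abs_nonneg _)
      rw [abs_mul, abs_of_nonneg (softmax_nonneg _ _ _)]
      exact mul_le_of_le_one_left (abs_nonneg _) (softmax_le_one _ _ _)
  refine ⟨integral_dotProduct_mul_stdPi (fun x => ?_) ?_ hint
    (integrable_linForms_mul_softmax_mul hθ hβ hM he hc i), hint⟩
  · have := hasDerivAt_softmax_mul_smoothExpMax (θ := θ) hβ.ne'
      (fun j => hasDerivAt_linForms e x (c i) j) i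
    unfold HasLineDerivAt
    convert! this using 1
    simp
    ring
  · exact integrable_bdd_mul_smoothExpMax hθ hβ he (continuous_softmax_linForms e i) (C := 1)
      fun x => (abs_of_nonneg (softmax_nonneg _ _ _)).le.trans (softmax_le_one _ _ _)

/-- After integration by parts the bracket is `β s` plus `θ - β` times a softmax average of numbers
at most `s`. As `θ - β ≤ 0`, it is at least `β s + (θ - β) s = θ s`. -/
lemma le_sum_integral_linForms_mul_softmax_mul (hθ : 0 ≤ θ) (hβ : 0 < β) (hθβ : θ ≤ β)
    (hM : 0 ≤ M) (he : ∀ i j, |e i j| ≤ M) (hc : ∀ i j, |c i j| ≤ M) {s : ℝ}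
    (hdiag : ∀ i, e i ⬝ᵥ c i = s) (hoff : ∀ i j, e j ⬝ᵥ c i ≤ s) :
    θ * s * ∫ x, smoothExpMax θ β (linForms e x) ∂stdPi J ≤
      ∑ i, ∫ x, (c i ⬝ᵥ x) *
        (softmax β (linForms e x) i * smoothExpMax θ β (linForms e x)) ∂stdPi J := by
  have H := integral_linForms_mul_softmax_mul hθ hβ hM he hc
  simp_rw [fun i => (H i).1]
  rw [← integral_finsetSum _ fun i _ => (H i).2, ← integral_const_mul]
  refine integral_mono ((integrable_smoothExpMax_linForms hθ hβ he).const_mul _)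
    (integrable_finsetSum _ fun i _ => (H i).2) fun x => ?_
  simp only [← Finset.sum_mul]
  refine mul_le_mul_of_nonneg_right ?_ (smoothExpMax_nonneg _ _ _)
  have h1 : ∀ i, ∑ j, softmax β (linForms e x) j * (e j ⬝ᵥ c i) ≤ s := fun i => by
    calc _ ≤ ∑ j, softmax β (linForms e x) j * s := Finset.sum_le_sum fun j _ =>
          mul_le_mul_of_nonneg_left (hoff i j) (softmax_nonneg _ _ _)
      _ = s := by rw [← Finset.sum_mul, sum_softmax, one_mul]
  calc θ * s = ∑ i, softmax β (linForms e x) i * (θ * s) := by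
        rw [← Finset.sum_mul, sum_softmax, one_mul]
    _ ≤ _ := Finset.sum_le_sum fun i _ => by
        refine mul_le_mul_of_nonneg_left ?_ (softmax_nonneg _ _ _)
        rw [hdiag]
        nlinarith [mul_le_mul_of_nonneg_left (h1 i) (sub_nonneg.2 hθβ)]

end Comparison

/-! ### The comparison inequality along a rotation from `a` to `b`. -/

section Interpolation

variable {ι J : Type*} {θ β M : ℝ} {a b : ι → J → ℝ}

lemma abs_smul_add_smul_le (ha : ∀ i j, |a i j| + |b i j| ≤ M) {p q : ℝ} (hp : |p| ≤ 1)
    (hq : |q| ≤ 1) (i : ι) (j : J) : |(p • a i + q • b i) j| ≤ M := by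
  refine (abs_add_le _ _).trans ((add_le_add ?_ ?_).trans (ha i j))
  · simpa [abs_mul] using mul_le_of_le_one_left (abs_nonneg _) hp
  · simpa [abs_mul] using mul_le_of_le_one_left (abs_nonneg _) hq

variable [Fintype J] [Fintype ι] [Nonempty ι]

lemma hasDerivAt_integral_smoothExpMax (hθ : 0 ≤ θ) (hβ : 0 < β) (hM : 0 ≤ M)
    (ha : ∀ i j, |a i j| + |b i j| ≤ M) (t : ℝ) :
    HasDerivAt (fun t => ∫ x, smoothExpMax θ β
        (linForms (fun i => Real.cos t • a i + Real.sin t • b i) x) ∂stdPi J)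
      (θ * ∑ i, ∫ x, ((-Real.sin t • a i + Real.cos t • b i) ⬝ᵥ x) *
        (softmax β (linForms (fun i => Real.cos t • a i + Real.sin t • b i) x) i *
          smoothExpMax θ β (linForms (fun i => Real.cos t • a i + Real.sin t • b i) x))
            ∂stdPi J) t := by
  have he : ∀ t i j, |(Real.cos t • a i + Real.sin t • b i) j| ≤ M := fun t =>
    abs_smul_add_smul_le ha (Real.abs_cos_le_one t) (Real.abs_sin_le_one t)
  have hc : ∀ t i j, |(-Real.sin t • a i + Real.cos t • b i) j| ≤ M := fun t =>
    abs_smul_add_smul_le ha (by simpa using Real.abs_sin_le_one t) (Real.abs_cos_le_one t)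
  let e : ℝ → ι → J → ℝ := fun t i => Real.cos t • a i + Real.sin t • b i
  let c : ℝ → ι → J → ℝ := fun t i => -Real.sin t • a i + Real.cos t • b i
  let F' : ℝ → (J → ℝ) → ℝ := fun t x => θ * ∑ i, (c t i ⬝ᵥ x) *
    (softmax β (linForms (e t) x) i * smoothExpMax θ β (linForms (e t) x))
  have hint : ∀ i, Integrable (fun x => (c t i ⬝ᵥ x) *
      (softmax β (linForms (e t) x) i * smoothExpMax θ β (linForms (e t) x))) (stdPi J) :=
    integrable_linForms_mul_softmax_mul hθ hβ hM (he t) (hc t)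
  have key := hasDerivAt_integral_of_dominated_loc_of_deriv_le (μ := stdPi J) (x₀ := t)
    (F := fun t x => smoothExpMax θ β (linForms (e t) x)) (F' := F')
    (bound := fun x => θ * ∑ _i : ι, M * Real.exp (θ / β * Real.log (Fintype.card ι)) *
        Real.exp ((θ * M + 1) * absSum x)) Filter.univ_mem
    (Filter.Eventually.of_forall fun s => ((continuous_smoothExpMax θ β).comp
      (continuous_linForms (e s))).aestronglyMeasurable)
    (integrable_smoothExpMax_linForms hθ hβ (he t))
    ((integrable_finsetSum _ fun i _ => hint i).const_mul θ).aestronglyMeasurable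
    (ae_of_all _ fun x s _ => ?_)
    ((integrable_finsetSum _ fun i _ => (integrable_exp_mul_absSum _).const_mul _).const_mul _)
    (ae_of_all _ fun x s _ => ?_)
  · convert! key.2 using 1
    simp only [F']
    rw [integral_const_mul, integral_finsetSum _ fun i _ => hint i]
  · simp only [F', norm_mul, Real.norm_eq_abs, abs_of_nonneg hθ]
    refine mul_le_mul_of_nonneg_left ((Finset.abs_sum_le_sum_abs _ _).trans
      (Finset.sum_le_sum fun i _ => ?_)) hθ
    exact abs_linForms_mul_softmax_mul_le hθ hβ hM (he s) (hc s) x i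
  · have h1 : ∀ i, HasDerivAt (fun r => linForms (e r) x i) (c s i ⬝ᵥ x) s := fun i => by
      simp only [linForms, e, c, add_dotProduct, smul_dotProduct, smul_eq_mul]
      exact ((Real.hasDerivAt_cos s).mul_const _).add ((Real.hasDerivAt_sin s).mul_const _)
    have := hasDerivAt_smoothExpMax (θ := θ) hβ.ne' h1
    convert! this using 1
    simp only [F', mul_assoc, Finset.mul_sum]
    exact Finset.sum_congr rfl fun i _ => by ring

/-- A Gaussian comparison inequality of Slepian type. -/
theorem integral_smoothExpMax_comparison (hθ : 0 ≤ θ) (hβ : 0 < β) (hθβ : θ ≤ β)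
    (hab : ∀ i j, a i ⬝ᵥ b j = 0) (hdiag : ∀ i, b i ⬝ᵥ b i - a i ⬝ᵥ a i = 1)
    (hoff : ∀ i j, b i ⬝ᵥ b j - a i ⬝ᵥ a j ≤ 1) :
    Real.exp (θ ^ 2 / 2) * ∫ x, smoothExpMax θ β (linForms a x) ∂stdPi J ≤
      ∫ x, smoothExpMax θ β (linForms b x) ∂stdPi J := by
  -- Bounding the sum of the two moduli controls every rotated coefficient, uniformly in the angle.
  obtain ⟨M, hM, ha⟩ : ∃ M : ℝ, 0 ≤ M ∧ ∀ i j, |a i j| + |b i j| ≤ M := by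
    refine ⟨∑ i, ∑ j, (|a i j| + |b i j|), by positivity, fun i j => ?_⟩
    exact (Finset.single_le_sum (f := fun j => |a i j| + |b i j|) (fun _ _ => by positivity)
      (Finset.mem_univ j)).trans (Finset.single_le_sum
        (f := fun i => ∑ j, (|a i j| + |b i j|)) (fun _ _ => by positivity) (Finset.mem_univ i))
  have he : ∀ t i j, |(Real.cos t • a i + Real.sin t • b i) j| ≤ M := fun t =>
    abs_smul_add_smul_le ha (Real.abs_cos_le_one t) (Real.abs_sin_le_one t)
  have hc : ∀ t i j, |(-Real.sin t • a i + Real.cos t • b i) j| ≤ M := fun t =>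
    abs_smul_add_smul_le ha (by simpa using Real.abs_sin_le_one t) (Real.abs_cos_le_one t)
  -- The covariance of the path with its velocity; cross terms vanish because `a` and `b` are
  -- orthogonal families.
  have hcov : ∀ t i j, (Real.cos t • a j + Real.sin t • b j) ⬝ᵥ
      (-Real.sin t • a i + Real.cos t • b i) =
        Real.sin t * Real.cos t * (b i ⬝ᵥ b j - a i ⬝ᵥ a j) := fun t i j => by
    have h1 : b j ⬝ᵥ a i = 0 := by rw [dotProduct_comm, hab]
    simp only [add_dotProduct, dotProduct_add, smul_dotProduct, dotProduct_smul, smul_eq_mul,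
      hab, h1, dotProduct_comm (a j) (a i), dotProduct_comm (b j) (b i)]
    ring
  set φ : ℝ → ℝ := fun t => ∫ x, smoothExpMax θ β
    (linForms (fun i => Real.cos t • a i + Real.sin t • b i) x) ∂stdPi J with hφ
  have hd := hasDerivAt_integral_smoothExpMax (a := a) (b := b) hθ hβ hM ha
  have hψ : ∀ t, HasDerivAt (fun t => φ t * Real.exp (-(θ ^ 2 / 2) * Real.sin t ^ 2)) _ t :=
    fun t => (hd t).mul ((((Real.hasDerivAt_sin t).pow 2).const_mul (-(θ ^ 2 / 2))).exp)
  -- The derivative bound reads `φ' ≥ θ² sin t cos t · φ`, and `exp (-(θ²/2) sin² t)` is its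
  -- integrating factor. The endpoints `0` and `π/2` give `a` and `b`.
  have hmono : MonotoneOn (fun t => φ t * Real.exp (-(θ ^ 2 / 2) * Real.sin t ^ 2))
      (Set.Icc 0 (Real.pi / 2)) := by
    refine monotoneOn_of_deriv_nonneg (convex_Icc _ _)
      (fun t _ => (hψ t).continuousAt.continuousWithinAt)
      (fun t _ => (hψ t).differentiableAt.differentiableWithinAt) fun t ht => ?_
    rw [interior_Icc] at ht
    rw [(hψ t).deriv]
    have hs : 0 ≤ Real.sin t * Real.cos t := mul_nonneg
      (Real.sin_nonneg_of_nonneg_of_le_pi ht.1.le (by linarith [ht.2, Real.pi_pos]))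
      (Real.cos_nonneg_of_neg_pi_div_two_le_of_le (by linarith [ht.1, Real.pi_pos]) ht.2.le)
    have h1 := le_sum_integral_linForms_mul_softmax_mul hθ hβ hθβ hM (he t) (hc t)
      (s := Real.sin t * Real.cos t) (fun i => by rw [hcov, hdiag, mul_one])
      (fun i j => by rw [hcov]; exact mul_le_of_le_one_right hs (hoff i j))
    have h2 := mul_le_mul_of_nonneg_left h1 hθ
    have h3 := mul_le_mul_of_nonneg_right h2
      (Real.exp_nonneg (-(θ ^ 2 / 2) * Real.sin t ^ 2))
    simp only [Pi.pow_apply] at h3 ⊢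
    push_cast
    nlinarith [h3]
  have := hmono (Set.left_mem_Icc.2 (by positivity)) (Set.right_mem_Icc.2 (by positivity))
    (by positivity : (0 : ℝ) ≤ Real.pi / 2)
  simp only [hφ, Real.cos_zero, Real.sin_zero, one_smul, zero_smul, add_zero, zero_add,
    Real.cos_pi_div_two, Real.sin_pi_div_two, ne_eq, OfNat.ofNat_ne_zero, not_false_eq_true,
    zero_pow, mul_zero, Real.exp_zero, mul_one, one_pow] at this
  calc _ ≤ Real.exp (θ ^ 2 / 2) * _ := mul_le_mul_of_nonneg_left this (Real.exp_nonneg _)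
    _ = _ := by
      rw [mul_comm, mul_assoc, ← Real.exp_add]
      simp

end Interpolation

/-! ### Exponential moments of the norm of a Gaussian vector. -/

section Chi

/-- The moment generating function of the square of a standard Gaussian variable. -/
lemma integral_exp_mul_sq_gaussianReal {r : ℝ} (hr : r < 1) :
    ∫ x, Real.exp (r / 2 * x ^ 2) ∂gaussianReal 0 1 = (√(1 - r))⁻¹ ∧
    Integrable (fun x => Real.exp (r / 2 * x ^ 2)) (gaussianReal 0 1) := by
  have hpos : 0 < (1 - r) / 2 := by linarith
  have h1 : ∀ x : ℝ, gaussianPDFReal 0 1 x * Real.exp (r / 2 * x ^ 2) =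
      (√(2 * Real.pi))⁻¹ * Real.exp (-((1 - r) / 2) * x ^ 2) := fun x => by
    simp only [gaussianPDFReal, NNReal.coe_one, mul_one, sub_zero, mul_assoc, ← Real.exp_add]
    congr 2
    ring
  constructor
  · rw [integral_gaussianReal_eq_integral_smul one_ne_zero]
    simp only [smul_eq_mul, h1]
    rw [integral_const_mul, integral_gaussian, ← Real.sqrt_inv, ← Real.sqrt_inv, ← Real.sqrt_mul
      (by positivity)]
    congr 1
    have : 1 - r ≠ 0 := by linarith
    field_simp
  · rw [gaussianReal_of_var_ne_zero _ one_ne_zero,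
      integrable_withDensity_iff_integrable_smul' (measurable_gaussianPDF 0 1)
      (ae_of_all _ fun _ => gaussianPDF_lt_top)]
    simp only [toReal_gaussianPDF, smul_eq_mul, h1]
    exact (integrable_exp_neg_mul_sq hpos).const_mul _

end Chi

section Chi

/-- Prepares `E exp (θ|g|) ≤ exp (θ√n + θ²/2)`. The inequality `θR ≤ rR²/2 + θ²/(2r)` replaces the
norm by its square, whose exponential moment is explicit. The choice `r = θ/(√n + θ)` makes `θ²/(2r)
= θ√n/2 + θ²/2`, and `1 + y ≤ exp y` bounds the moment by the other `exp (θ√n/2)`. -/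
lemma exists_chi_bound {n : ℕ} (hn : 1 ≤ n) {θ : ℝ} (hθ : 0 < θ) :
    ∃ r : ℝ, r < 1 ∧
      (∀ R : ℝ, θ * R ≤ r / 2 * R ^ 2 + (θ * √n / 2 + θ ^ 2 / 2)) ∧
      (√(1 - r))⁻¹ ^ n ≤ Real.exp (θ * √n / 2) := by
  have hn' : (0 : ℝ) < √n := Real.sqrt_pos.2 (by exact_mod_cast hn)
  have hsq : √(n : ℝ) ^ 2 = n := Real.sq_sqrt (Nat.cast_nonneg n)
  set q := √(n : ℝ) with hq
  have hp : 0 < q + θ := by positivity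
  refine ⟨θ / (q + θ), (div_lt_one hp).2 (by linarith), fun R => ?_, ?_⟩
  · have : θ / (q + θ) / 2 * R ^ 2 + (θ * q / 2 + θ ^ 2 / 2) - θ * R =
        θ / (2 * (q + θ)) * (R - (q + θ)) ^ 2 := by
      field_simp
      ring
    have h2 : 0 ≤ θ / (2 * (q + θ)) * (R - (q + θ)) ^ 2 := by positivity
    linarith
  · have h1 : 1 - θ / (q + θ) = (1 + θ / q)⁻¹ := by
      field_simp
      ring
    rw [h1, Real.sqrt_inv, inv_inv]
    have h2 : √(1 + θ / q) ≤ Real.exp (θ / q / 2) := by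
      rw [Real.exp_half]
      exact Real.sqrt_le_sqrt (by linarith [Real.add_one_le_exp (θ / q)])
    calc _ ≤ Real.exp (θ / q / 2) ^ n := pow_le_pow_left₀ (Real.sqrt_nonneg _) h2 n
      _ = _ := by
        rw [← Real.exp_nat_mul, ← hsq]
        congr 1
        field_simp

end Chi

/-! ### Tail of the maximum of `uᵀGv` over finitely many pairs of unit vectors. -/

section Chevet

variable {m n : ℕ} {ι : Type*}

/-- The coefficients of `uᵀ G v`. -/
def bilinCoeff (u : ι → Fin m → ℝ) (v : ι → Fin n → ℝ) (i : ι) :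
    (Fin m × Fin n) ⊕ (Fin m ⊕ Fin n) → ℝ :=
  Sum.elim (fun p => u i p.1 * v i p.2) 0

/-- The coefficients of `⟨u, g⟩ + ⟨v, h⟩`. -/
def sumCoeff (u : ι → Fin m → ℝ) (v : ι → Fin n → ℝ) (i : ι) :
    (Fin m × Fin n) ⊕ (Fin m ⊕ Fin n) → ℝ :=
  Sum.elim 0 (Sum.elim (u i) (v i))

lemma bilinCoeff_dotProduct_bilinCoeff (u : ι → Fin m → ℝ) (v : ι → Fin n → ℝ) (i j : ι) :
    bilinCoeff u v i ⬝ᵥ bilinCoeff u v j = (u i ⬝ᵥ u j) * (v i ⬝ᵥ v j) := by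
  simp only [bilinCoeff, dotProduct, Fintype.sum_sum_type, Sum.elim_inl, Sum.elim_inr,
    Pi.zero_apply, mul_zero, Finset.sum_const_zero, add_zero, Fintype.sum_prod_type,
    Finset.sum_mul_sum]
  exact Finset.sum_congr rfl fun _ _ => Finset.sum_congr rfl fun _ _ => by ring

lemma sumCoeff_dotProduct_sumCoeff (u : ι → Fin m → ℝ) (v : ι → Fin n → ℝ) (i j : ι) :
    sumCoeff u v i ⬝ᵥ sumCoeff u v j = u i ⬝ᵥ u j + v i ⬝ᵥ v j := by
  simp [sumCoeff, dotProduct]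

lemma bilinCoeff_dotProduct_sumCoeff (u : ι → Fin m → ℝ) (v : ι → Fin n → ℝ) (i j : ι) :
    bilinCoeff u v i ⬝ᵥ sumCoeff u v j = 0 := by
  simp [bilinCoeff, sumCoeff, dotProduct]

lemma dotProduct_le_sqrt_of_unit {n : ℕ} {u : Fin n → ℝ} (hu : u ⬝ᵥ u = 1) (g : Fin n → ℝ) :
    u ⬝ᵥ g ≤ √(∑ i, g i ^ 2) := by
  have h := Real.sum_mul_le_sqrt_mul_sqrt Finset.univ u g
  have hu' : ∑ i, u i ^ 2 = 1 := by simpa [dotProduct, sq] using hu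
  rwa [hu', Real.sqrt_one, one_mul] at h

lemma dotProduct_le_one_of_unit {n : ℕ} {u u' : Fin n → ℝ} (hu : u ⬝ᵥ u = 1)
    (hu' : u' ⬝ᵥ u' = 1) : u ⬝ᵥ u' ≤ 1 := by
  have := dotProduct_le_sqrt_of_unit hu u'
  rwa [show ∑ i, u' i ^ 2 = 1 by simpa [dotProduct, sq] using hu', Real.sqrt_one] at this

variable [Fintype ι] [Nonempty ι] {u : ι → Fin m → ℝ} {v : ι → Fin n → ℝ} {θ β : ℝ}

/-- Every form is at most `|g| + |h|`, and `exists_chi_bound` turns its exponential into a product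
over coordinates. -/
lemma integral_smoothExpMax_sumCoeff_le (hm : 1 ≤ m) (hn : 1 ≤ n) (hu : ∀ i, u i ⬝ᵥ u i = 1)
    (hv : ∀ i, v i ⬝ᵥ v i = 1) (hθ : 0 < θ) (hβ : 0 < β) :
    ∫ x, smoothExpMax θ β (linForms (sumCoeff u v) x) ∂stdPi ((Fin m × Fin n) ⊕ (Fin m ⊕ Fin n)) ≤
      Real.exp (θ / β * Real.log (Fintype.card ι)) * Real.exp (θ * (√m + √n) + θ ^ 2) := by
  obtain ⟨r, hr, hr1, hr2⟩ := exists_chi_bound hm hθ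
  obtain ⟨s, hs, hs1, hs2⟩ := exists_chi_bound hn hθ
  set C := Real.exp (θ / β * Real.log (Fintype.card ι))
  let f : (Fin m × Fin n) ⊕ (Fin m ⊕ Fin n) → ℝ → ℝ :=
    Sum.elim (fun _ _ => 1) (Sum.elim (fun _ y => Real.exp (r / 2 * y ^ 2))
      (fun _ y => Real.exp (s / 2 * y ^ 2)))
  have hf : Integrable (fun x => ∏ j, f j (x j))
      (stdPi ((Fin m × Fin n) ⊕ (Fin m ⊕ Fin n))) := by
    refine Integrable.fintype_prod fun j => ?_
    rcases j with p | i | i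
    · exact integrable_const _
    · exact (integral_exp_mul_sq_gaussianReal hr).2
    · exact (integral_exp_mul_sq_gaussianReal hs).2
  set K := C * Real.exp (θ * √m / 2 + θ ^ 2 / 2 + (θ * √n / 2 + θ ^ 2 / 2))
  have hle : ∀ x, smoothExpMax θ β (linForms (sumCoeff u v) x) ≤ K * ∏ j, f j (x j) := fun x => by
    set R := √(∑ i : Fin m, x (Sum.inr (Sum.inl i)) ^ 2)
    set S := √(∑ i : Fin n, x (Sum.inr (Sum.inr i)) ^ 2)
    have hR : R ^ 2 = _ := Real.sq_sqrt (Finset.sum_nonneg fun _ _ => sq_nonneg _)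
    have hS : S ^ 2 = _ := Real.sq_sqrt (Finset.sum_nonneg fun _ _ => sq_nonneg _)
    have h1 : ∀ i, linForms (sumCoeff u v) x i ≤ R + S := fun i => by
      have : linForms (sumCoeff u v) x i = u i ⬝ᵥ (fun k => x (Sum.inr (Sum.inl k))) +
          v i ⬝ᵥ (fun k => x (Sum.inr (Sum.inr k))) := by
        simp [linForms, sumCoeff, dotProduct]
      rw [this]
      exact add_le_add (dotProduct_le_sqrt_of_unit (hu i) _) (dotProduct_le_sqrt_of_unit (hv i) _)
    have h2 : ∏ j, f j (x j) = Real.exp (r / 2 * R ^ 2 + s / 2 * S ^ 2) := by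
      simp only [f, Fintype.prod_sum_type, Sum.elim_inl, Sum.elim_inr, Finset.prod_const_one,
        one_mul, ← Real.exp_sum, ← Finset.mul_sum, ← Real.exp_add, hR, hS]
    rw [h2, mul_assoc, ← Real.exp_add]
    refine (smoothExpMax_le hθ.le hβ h1).trans (mul_le_mul_of_nonneg_left
      (Real.exp_le_exp.2 ?_) (Real.exp_nonneg _))
    linarith [hr1 R, hs1 S]
  refine (integral_mono_of_nonneg (ae_of_all _ fun x => smoothExpMax_nonneg _ _ _)
    (hf.const_mul K) (ae_of_all _ hle)).trans ?_
  rw [integral_const_mul, integral_fintype_prod_eq_prod f]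
  have h3 : ∏ j, ∫ y, f j y ∂gaussianReal 0 1 = (√(1 - r))⁻¹ ^ m * (√(1 - s))⁻¹ ^ n := by
    simp only [f, Fintype.prod_sum_type, Sum.elim_inl, Sum.elim_inr,
      (integral_exp_mul_sq_gaussianReal hr).1, (integral_exp_mul_sq_gaussianReal hs).1]
    simp
  rw [h3, mul_assoc C]
  refine mul_le_mul_of_nonneg_left ?_ (Real.exp_nonneg _)
  calc _ ≤ Real.exp (θ * √m / 2 + θ ^ 2 / 2 + (θ * √n / 2 + θ ^ 2 / 2)) *
        (Real.exp (θ * √m / 2) * Real.exp (θ * √n / 2)) := by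
        gcongr
    _ = _ := by
      rw [← Real.exp_add, ← Real.exp_add]
      congr 1
      ring

/-- Markov's inequality with `θ = t`: the exponent is `t(√m + √n) + t² - t²/2 - t(√m + √n + t) =
-t²/2`. -/
lemma measure_exists_linForms_gt_le (hm : 1 ≤ m) (hn : 1 ≤ n) (hu : ∀ i, u i ⬝ᵥ u i = 1)
    (hv : ∀ i, v i ⬝ᵥ v i = 1) {t : ℝ} (ht : 0 < t) :
    stdPi ((Fin m × Fin n) ⊕ (Fin m ⊕ Fin n))
        {x | ∃ i, √m + √n + t < linForms (bilinCoeff u v) x i} ≤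
      ENNReal.ofReal (Real.exp (-t ^ 2 / 2)) := by
  set γ := stdPi ((Fin m × Fin n) ⊕ (Fin m ⊕ Fin n))
  set A := {x | ∃ i, √m + √n + t < linForms (bilinCoeff u v) x i}
  set c := √(m : ℝ) + √(n : ℝ) + t
  have key : ∀ β, t ≤ β → γ.real A ≤
      Real.exp (t / β * Real.log (Fintype.card ι)) * Real.exp (-t ^ 2 / 2) := fun β hβ => by
    have hβ0 : 0 < β := ht.trans_le hβ
    have h1 := integral_smoothExpMax_comparison (a := bilinCoeff u v) (b := sumCoeff u v) ht.le hβ0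
      hβ (bilinCoeff_dotProduct_sumCoeff u v)
      (fun i => by
        rw [sumCoeff_dotProduct_sumCoeff, bilinCoeff_dotProduct_bilinCoeff, hu, hv]; norm_num)
      -- With `p = uᵢ·uⱼ` and `q = vᵢ·vⱼ`, the covariance gap is `p + q - pq = 1 - (1 - p)(1 - q) ≤
      -- 1`.
      (fun i j => by
        rw [sumCoeff_dotProduct_sumCoeff, bilinCoeff_dotProduct_bilinCoeff]
        nlinarith [dotProduct_le_one_of_unit (hu i) (hu j),
          dotProduct_le_one_of_unit (hv i) (hv j)])
    have h2 := h1.trans (integral_smoothExpMax_sumCoeff_le hm hn hu hv ht hβ0)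
    obtain ⟨M, hM⟩ : ∃ M : ℝ, ∀ i j, |bilinCoeff u v i j| ≤ M :=
      ⟨∑ i, ∑ j, |bilinCoeff u v i j|, fun i j => (Finset.single_le_sum
        (f := fun j => |bilinCoeff u v i j|) (fun _ _ => abs_nonneg _) (Finset.mem_univ j)).trans
        (Finset.single_le_sum (f := fun i => ∑ j, |bilinCoeff u v i j|)
          (fun _ _ => by positivity) (Finset.mem_univ i))⟩
    have hint := integrable_smoothExpMax_linForms (J := (Fin m × Fin n) ⊕ (Fin m ⊕ Fin n))
      ht.le hβ0 hM
    have h3 := mul_meas_ge_le_integral_of_nonneg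
      (ae_of_all _ fun x => smoothExpMax_nonneg t β (linForms (bilinCoeff u v) x)) hint
      (Real.exp (t * c))
    have h4 : γ.real A ≤ γ.real {x | Real.exp (t * c) ≤
        smoothExpMax t β (linForms (bilinCoeff u v) x)} := by
      refine measureReal_mono fun x ⟨i, hi⟩ => ?_
      exact (Real.exp_le_exp.2 (mul_le_mul_of_nonneg_left hi.le ht.le)).trans
        (exp_mul_le_smoothExpMax ht.le hβ0 _ i)
    have h5 : Real.exp (t ^ 2 / 2) * (Real.exp (t * c) * γ.real A) ≤
        Real.exp (t / β * Real.log (Fintype.card ι)) *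
          Real.exp (t * (√(m : ℝ) + √(n : ℝ)) + t ^ 2) :=
      (mul_le_mul_of_nonneg_left ((mul_le_mul_of_nonneg_left h4 (Real.exp_nonneg _)).trans h3)
        (Real.exp_nonneg _)).trans h2
    rw [← mul_assoc, ← Real.exp_add, mul_comm, ← le_div_iff₀ (Real.exp_pos _), mul_div_assoc,
      ← Real.exp_sub] at h5
    refine h5.trans_eq ?_
    congr 2
    simp only [c]
    ring
  -- Letting `β → ∞` removes the dependence on the number of pairs, so the family may later grow to
  -- a dense one.
  have hlim : Filter.Tendsto (fun β : ℝ => Real.exp (t / β * Real.log (Fintype.card ι)) *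
      Real.exp (-t ^ 2 / 2)) Filter.atTop (nhds (Real.exp (-t ^ 2 / 2))) := by
    have h1 : Filter.Tendsto (fun β : ℝ => t / β * Real.log (Fintype.card ι)) Filter.atTop
        (nhds 0) := by
      simpa using (tendsto_const_nhds.div_atTop Filter.tendsto_id).mul_const
        (Real.log (Fintype.card ι))
    simpa using ((Real.continuous_exp.tendsto _).comp h1).mul_const (Real.exp (-t ^ 2 / 2))
  have hfin := ge_of_tendsto hlim (Filter.eventually_atTop.2 ⟨t, key⟩)
  exact (ENNReal.le_ofReal_iff_toReal_le (measure_ne_top _ _) (Real.exp_nonneg _)).2 hfin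

end Chevet

open scoped Matrix.Norms.L2Operator

/-! ### The operator norm as a supremum of bilinear forms over a dense sequence. -/

section OpNorm

variable {m n : ℕ}

lemma l2_opNorm_le_of_mulVec_le {A : Mat m n} {c : ℝ} (hc : 0 ≤ c)
    (h : ∀ x : Vec n, ‖WithLp.toLp 2 (A *ᵥ x.ofLp)‖ ≤ c * ‖x‖) : ‖A‖ ≤ c := by
  rw [Matrix.l2_opNorm_def]
  exact ContinuousLinearMap.opNorm_le_bound _ hc h

lemma norm_mulVec_le (A : Mat m n) (x : Vec n) :
    ‖WithLp.toLp 2 (A *ᵥ x.ofLp)‖ ≤ ‖A‖ * ‖x‖ :=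
  Matrix.l2_opNorm_mulVec A x

lemma l2_opNorm_transpose (A : Mat m n) : ‖Aᵀ‖ = ‖A‖ := by
  rw [← Matrix.conjTranspose_eq_transpose_of_trivial, Matrix.l2_opNorm_conjTranspose]

lemma dotProduct_self_eq_norm_sq {n : ℕ} (x : Vec n) : x.ofLp ⬝ᵥ x.ofLp = ‖x‖ ^ 2 := by
  simp [EuclideanSpace.real_norm_sq_eq, dotProduct, ← sq]

lemma l2_opNorm_le_of_dense {A : Mat m n} {c : ℝ} (hc : 0 ≤ c)
    {p : ℕ → Metric.sphere (0 : Vec m) 1 × Metric.sphere (0 : Vec n) 1} (hp : DenseRange p)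
    (h : ∀ k, (p k).1.1.ofLp ⬝ᵥ (A *ᵥ (p k).2.1.ofLp) ≤ c) : ‖A‖ ≤ c := by
  have hall : ∀ q : Metric.sphere (0 : Vec m) 1 × Metric.sphere (0 : Vec n) 1,
      q.1.1.ofLp ⬝ᵥ (A *ᵥ q.2.1.ofLp) ≤ c := by
    intro q
    refine hp.induction_on (p := fun q => q.1.1.ofLp ⬝ᵥ (A *ᵥ q.2.1.ofLp) ≤ c) q ?_ h
    refine isClosed_le ?_ continuous_const
    exact Continuous.dotProduct (by fun_prop) (Continuous.matrix_mulVec (by fun_prop) (by fun_prop))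
  refine l2_opNorm_le_of_mulVec_le hc fun x => ?_
  set y : Vec m := WithLp.toLp 2 (A *ᵥ x.ofLp) with hy
  rcases eq_or_ne y 0 with h0 | h0
  · rw [h0, norm_zero]
    positivity
  have hx : x ≠ 0 := by
    rintro rfl
    exact h0 (by simp [hy])
  have hxn := norm_pos_iff.2 hx
  have hyn := norm_pos_iff.2 h0
  have h1 := hall (⟨‖y‖⁻¹ • y, by simp [norm_smul, hyn.ne']⟩, ⟨‖x‖⁻¹ • x, by
    simp [norm_smul, hxn.ne']⟩)
  have h2 : (‖y‖⁻¹ • y).ofLp ⬝ᵥ (A *ᵥ (‖x‖⁻¹ • x).ofLp) = ‖y‖ / ‖x‖ := by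
    rw [WithLp.ofLp_smul, WithLp.ofLp_smul, Matrix.mulVec_smul, smul_dotProduct, dotProduct_smul,
      show A *ᵥ x.ofLp = y.ofLp from rfl, dotProduct_self_eq_norm_sq]
    simp only [smul_eq_mul]
    field_simp
  simp only [h2] at h1
  rwa [div_le_iff₀ hxn] at h1

end OpNorm

/-! ### Tail of the operator norm of a Gaussian matrix. -/

section Tail

variable {m n : ℕ}

/-- Discards the auxiliary vectors `g` and `h`, which share a space with `G` only for the
comparison. -/
lemma measurePreserving_stdPi_inl {α β : Type*} [Fintype α] [Fintype β] :
    MeasurePreserving (fun (x : α ⊕ β → ℝ) a => x (Sum.inl a)) (stdPi (α ⊕ β)) (stdPi α) :=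
  measurePreserving_fst.comp
    (measurePreserving_sumPiEquivProdPi fun _ : α ⊕ β => gaussianReal 0 1)

lemma linForms_bilinCoeff {ι : Type*} (u : ι → Fin m → ℝ) (v : ι → Fin n → ℝ)
    (x : (Fin m × Fin n) ⊕ (Fin m ⊕ Fin n) → ℝ) (i : ι) :
    linForms (bilinCoeff u v) x i =
      u i ⬝ᵥ (Matrix.of (fun a b => x (Sum.inl (a, b))) *ᵥ v i) := by
  simp only [linForms, bilinCoeff, dotProduct, Fintype.sum_sum_type, Sum.elim_inl, Sum.elim_inr,
    Pi.zero_apply, zero_mul, Finset.sum_const_zero, add_zero, Fintype.sum_prod_type,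
    Matrix.mulVec, Matrix.of_apply, Finset.mul_sum]
  exact Finset.sum_congr rfl fun _ _ => Finset.sum_congr rfl fun _ _ => by ring

/-- The events for the first `N + 1` pairs of a dense sequence increase to one containing the norm
event, and their bound does not depend on `N`. -/
lemma stdPi_l2_opNorm_gt_le (hm : 1 ≤ m) (hn : 1 ≤ n) {t : ℝ} (ht : 0 < t) :
    stdPi (Fin m × Fin n) {x | √m + √n + t < ‖(Matrix.of fun a b => x (a, b) : Mat m n)‖} ≤
      ENNReal.ofReal (Real.exp (-t ^ 2 / 2)) := by
  have hne : ∀ {k : ℕ}, 1 ≤ k → Nonempty (Metric.sphere (0 : Vec k) 1) := fun hk =>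
    ⟨⟨EuclideanSpace.single ⟨0, hk⟩ 1, by simp⟩⟩
  have := hne hm
  have := hne hn
  let p := TopologicalSpace.denseSeq
    (Metric.sphere (0 : Vec m) 1 × Metric.sphere (0 : Vec n) 1)
  set c := √(m : ℝ) + √(n : ℝ) + t
  let B : ℕ → Set (Fin m × Fin n → ℝ) := fun N => {x | ∃ i : Fin (N + 1),
    c < (p i).1.1.ofLp ⬝ᵥ ((Matrix.of fun a b => x (a, b)) *ᵥ (p i).2.1.ofLp)}
  have hBopen : ∀ N, IsOpen (B N) := fun N => by
    simp only [B, Set.ofPred_exists]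
    refine isOpen_iUnion fun i => isOpen_lt continuous_const ?_
    exact continuous_const.dotProduct (Continuous.matrix_mulVec
      (continuous_matrix fun a b => by simpa using continuous_apply (a, b)) continuous_const)
  have hBmono : Monotone B := fun N N' h x ⟨i, hi⟩ =>
    ⟨⟨i, i.2.trans_le (Nat.succ_le_succ h)⟩, hi⟩
  have hunit : ∀ {k : ℕ} (x : Metric.sphere (0 : Vec k) 1), x.1.ofLp ⬝ᵥ x.1.ofLp = 1 :=
    fun x => by rw [dotProduct_self_eq_norm_sq]; simp
  have hB : ∀ N, stdPi (Fin m × Fin n) (B N) ≤ ENNReal.ofReal (Real.exp (-t ^ 2 / 2)) := fun N => by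
    rw [← (measurePreserving_stdPi_inl (α := Fin m × Fin n) (β := Fin m ⊕ Fin n)).measure_preimage
      (hBopen N).measurableSet.nullMeasurableSet]
    have := measure_exists_linForms_gt_le (ι := Fin (N + 1)) (u := fun i => (p i).1.1.ofLp)
      (v := fun i => (p i).2.1.ofLp) hm hn (fun i => hunit _) (fun i => hunit _) ht
    simp only [linForms_bilinCoeff] at this
    exact this
  calc _ ≤ stdPi (Fin m × Fin n) (⋃ N, B N) := by
        refine measure_mono fun x hx => ?_
        by_contra hcon
        refine not_le.2 hx (l2_opNorm_le_of_dense (by positivity)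
          (TopologicalSpace.denseRange_denseSeq _) fun k => ?_)
        by_contra hk
        exact hcon (Set.mem_iUnion.2 ⟨k, ⟨k, Nat.lt_succ_self k⟩, not_le.1 hk⟩)
    _ = ⨆ N, stdPi (Fin m × Fin n) (B N) := hBmono.measure_iUnion
    _ ≤ _ := iSup_le hB

variable {Ω : Type*} [MeasurableSpace Ω] {μ : Measure Ω}

/-- The concentration bound for the operator norm of a Gaussian matrix. -/
theorem measure_l2_opNorm_gt_le (hm : 1 ≤ m) (hn : 1 ≤ n) {G : Ω → Mat m n} {s : ℝ} (hs : 0 < s)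
    (hG : GaussianEntries μ G s) (hindep : iIndepFun (entries G) μ) {t : ℝ} (ht : 0 < t) :
    μ {ω | (√m + √n + t) * √s < ‖G ω‖} ≤ ENNReal.ofReal (Real.exp (-t ^ 2 / 2)) := by
  have hs' : 0 < √s := Real.sqrt_pos.2 hs
  let X : Fin m × Fin n → Ω → ℝ := fun q ω => entries G q ω / √s
  have hX : ∀ q, HasLaw (X q) (gaussianReal 0 1) μ := fun q => by
    have := gaussianReal_div_const (hG q.1 q.2) (√s)
    convert! this using 2
    · simp
    · rw [NNReal.eq_iff]
      simp [Real.sq_sqrt hs.le, max_eq_left hs.le, hs.ne']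
  have hXi : iIndepFun X μ :=
    hindep.comp (fun _ x => x / √s) fun _ => measurable_id.div_const _
  have hlaw := hXi.hasLaw_pi hX
  have hmeas : MeasurableSet
      {x : Fin m × Fin n → ℝ | √m + √n + t < ‖(Matrix.of fun a b => x (a, b) : Mat m n)‖} :=
    (isOpen_lt continuous_const (continuous_matrix fun a b => by
      simpa using continuous_apply (a, b)).norm).measurableSet
  calc _ = μ ((fun ω q => X q ω) ⁻¹'
        {x | √m + √n + t < ‖(Matrix.of fun a b => x (a, b) : Mat m n)‖}) := by
        congr 1
        ext ω
        have h1 : (Matrix.of fun a b => X (a, b) ω : Mat m n) = (√s)⁻¹ • G ω := by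
          ext a b
          simp [X, entries, div_eq_inv_mul]
        simp only [Set.mem_ofPred_eq, Set.mem_preimage, h1, norm_smul, norm_inv, Real.norm_eq_abs,
          abs_of_pos hs']
        rw [← div_eq_inv_mul, lt_div_iff₀ hs']
    _ = stdPi (Fin m × Fin n) _ := by
        rw [← Measure.map_apply_of_aemeasurable hlaw.aemeasurable hmeas, hlaw.map_eq]
    _ ≤ _ := stdPi_l2_opNorm_gt_le hm hn ht

end Tail

/-! ### Frobenius norm and matrix gradients. -/

section Frobenius

variable {m n : ℕ}

lemma frobNorm_nonneg (v : Mat m n) : 0 ≤ frobNorm v := Real.sqrt_nonneg _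

lemma frobNorm_sq (v : Mat m n) : frobNorm v ^ 2 = ∑ i, ∑ j, v i j ^ 2 := by
  simp only [frobNorm, sq_abs]
  exact Real.sq_sqrt (by positivity)

lemma l2_opNorm_le_frobNorm (v : Mat m n) : ‖v‖ ≤ frobNorm v := by
  refine l2_opNorm_le_of_mulVec_le (frobNorm_nonneg v) fun x => ?_
  refine abs_le_of_sq_le_sq' ?_ (mul_nonneg (frobNorm_nonneg v) (norm_nonneg x)) |>.2
  rw [mul_pow, frobNorm_sq, EuclideanSpace.real_norm_sq_eq, EuclideanSpace.real_norm_sq_eq,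
    Finset.sum_mul]
  refine Finset.sum_le_sum fun i _ => ?_
  exact Finset.sum_mul_sq_le_sq_mul_sq Finset.univ (v i) x.ofLp

lemma hasLineDerivAt_frobNorm_sq (v : Mat m n) (i : Fin m) (j : Fin n) :
    HasLineDerivAt ℝ (fun v : Mat m n => frobNorm v ^ 2) (2 * v i j) v (Matrix.single i j 1) := by
  unfold HasLineDerivAt
  simp only [frobNorm_sq, Matrix.add_apply, Matrix.smul_apply, smul_eq_mul]
  have h1 : ∀ a b, HasDerivAt (fun t : ℝ => (v a b + t * Matrix.single i j (1 : ℝ) a b) ^ 2)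
      (2 * v a b * Matrix.single i j (1 : ℝ) a b) 0 := fun a b => by
    have := (((hasDerivAt_id (0 : ℝ)).mul_const
      (Matrix.single i j (1 : ℝ) a b)).const_add (v a b)).pow 2
    convert! this using 1
    simp
  have h2 := HasDerivAt.fun_sum (u := Finset.univ) fun a _ =>
    HasDerivAt.fun_sum (u := Finset.univ) fun b _ => h1 a b
  convert! h2 using 1
  simp [Matrix.single_apply, ite_and]

lemma differentiable_entry (i : Fin m) (j : Fin n) :
    Differentiable ℝ fun v : Mat m n => v i j :=
  (LinearMap.toContinuousLinearMap (Matrix.entryLinearMap ℝ ℝ i j)).differentiable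

/-- The matrix gradient of a function that is Lipschitz for the operator norm. -/
lemma frobNorm_matGrad_le {F : Mat m n → ℝ} {v : Mat m n} (hF : DifferentiableAt ℝ F v) {C : ℝ}
    (hC : 0 ≤ C) (h : ∀ v', |F v' - F v| ≤ C * ‖v' - v‖) : frobNorm (matGrad F v) ≤ C := by
  set D := matGrad F v with hD
  have hDij : ∀ i j, D i j = fderiv ℝ F v (Matrix.single i j 1) := fun i j =>
    hF.lineDeriv_eq_fderiv
  -- The derivative is tested on the gradient itself; the operator norm being at most the Frobenius
  -- norm then gives `‖D‖_F² ≤ C ‖D‖_F`.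
  have h1 : fderiv ℝ F v D = frobNorm D ^ 2 := by
    rw [frobNorm_sq]
    conv_lhs => rw [Matrix.matrix_eq_sum_single D]
    rw [map_sum]
    refine Finset.sum_congr rfl fun i _ => ?_
    rw [map_sum]
    refine Finset.sum_congr rfl fun j _ => ?_
    rw [show Matrix.single i j (D i j) = D i j • Matrix.single i j (1 : ℝ) by
      simp [Matrix.smul_single], map_smul, ← hDij, smul_eq_mul, sq]
  have h2 : ‖fderiv ℝ F v‖ ≤ C := norm_fderiv_le_of_lip' ℝ hC (Filter.Eventually.of_forall h)
  have h3 : frobNorm D ^ 2 ≤ C * frobNorm D := by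
    rw [← h1]
    refine (le_abs_self _).trans (((fderiv ℝ F v).le_opNorm D).trans ?_)
    exact mul_le_mul h2 (l2_opNorm_le_frobNorm D) (norm_nonneg _) hC
  by_contra hcon
  have hlt := not_le.1 hcon
  nlinarith [hC.trans_lt hlt]

end Frobenius

/-! ### Lipschitz bounds for the network and growth of the weights. -/

section Network

variable {din d dout k : ℕ} {σ : ℝ → ℝ}

/-- The vector `σ(vᵀ x)` of the hidden layer. -/
noncomputable def hidden (σ : ℝ → ℝ) (x : Vec din) (v : Mat din d) : Vec d :=
  WithLp.toLp 2 fun j => σ ((vᵀ *ᵥ x.ofLp) j)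

lemma network_eq (x : Vec din) (v : Mat din d) (w : Mat d dout) :
    network σ x v w = WithLp.toLp 2 (wᵀ *ᵥ (hidden σ x v).ofLp) := rfl

lemma norm_transpose_mulVec_le (v : Mat din d) (x : Vec din) :
    ‖WithLp.toLp 2 (vᵀ *ᵥ x.ofLp)‖ ≤ ‖v‖ * ‖x‖ := by
  simpa only [l2_opNorm_transpose] using norm_mulVec_le vᵀ x

lemma norm_hidden_sub_le (hσ : LipschitzWith 1 σ) (x x' : Vec din) (v v' : Mat din d) :
    ‖hidden σ x v - hidden σ x' v'‖ ≤
      ‖WithLp.toLp 2 (vᵀ *ᵥ x.ofLp) - WithLp.toLp 2 (v'ᵀ *ᵥ x'.ofLp)‖ := by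
  refine abs_le_of_sq_le_sq' ?_ (norm_nonneg _) |>.2
  rw [EuclideanSpace.real_norm_sq_eq, EuclideanSpace.real_norm_sq_eq]
  refine Finset.sum_le_sum fun j _ => sq_le_sq.2 ?_
  simpa [hidden, Real.dist_eq] using hσ.dist_le_mul ((vᵀ *ᵥ x.ofLp) j) ((v'ᵀ *ᵥ x'.ofLp) j)

lemma norm_hidden_le (hσ : LipschitzWith 1 σ) (h0 : σ 0 = 0) (x : Vec din) (v : Mat din d) :
    ‖hidden σ x v‖ ≤ ‖v‖ * ‖x‖ := by
  have h1 : hidden σ x (0 : Mat din d) = 0 := by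
    ext j
    simp [hidden, h0]
  have h2 := norm_hidden_sub_le hσ x x v 0
  rw [h1, sub_zero] at h2
  refine h2.trans ?_
  simpa using norm_transpose_mulVec_le v x

lemma norm_network_sub_le_of_left (hσ : LipschitzWith 1 σ) (x : Vec din) (v v' : Mat din d)
    (w : Mat d dout) :
    ‖network σ x v' w - network σ x v w‖ ≤ ‖w‖ * ‖x‖ * ‖v' - v‖ := by
  rw [network_eq, network_eq, ← WithLp.toLp_sub, ← Matrix.mulVec_sub, ← WithLp.ofLp_sub]
  refine (norm_transpose_mulVec_le w _).trans ?_
  rw [mul_assoc]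
  refine mul_le_mul_of_nonneg_left ((norm_hidden_sub_le hσ x x v' v).trans ?_) (norm_nonneg _)
  rw [← WithLp.toLp_sub, ← Matrix.sub_mulVec, ← Matrix.transpose_sub, mul_comm]
  exact norm_transpose_mulVec_le _ _

lemma norm_network_sub_le_of_right (hσ : LipschitzWith 1 σ) (h0 : σ 0 = 0) (x : Vec din)
    (v : Mat din d) (w w' : Mat d dout) :
    ‖network σ x v w' - network σ x v w‖ ≤ ‖v‖ * ‖x‖ * ‖w' - w‖ := by
  rw [network_eq, network_eq, ← WithLp.toLp_sub, ← Matrix.sub_mulVec, ← Matrix.transpose_sub]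
  refine (norm_transpose_mulVec_le _ _).trans ?_
  rw [mul_comm]
  exact mul_le_mul_of_nonneg_right (norm_hidden_le hσ h0 x v) (norm_nonneg _)

lemma norm_network_sub_le_of_input (hσ : LipschitzWith 1 σ) (x x' : Vec din)
    (v : Mat din d) (w : Mat d dout) :
    ‖network σ x' v w - network σ x v w‖ ≤ ‖v‖ * ‖w‖ * ‖x' - x‖ := by
  rw [network_eq, network_eq, ← WithLp.toLp_sub, ← Matrix.mulVec_sub, ← WithLp.ofLp_sub]
  refine (norm_transpose_mulVec_le w _).trans ?_
  rw [mul_comm ‖v‖, mul_assoc]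
  refine mul_le_mul_of_nonneg_left ((norm_hidden_sub_le hσ x' x v v).trans ?_) (norm_nonneg _)
  rw [← WithLp.toLp_sub, ← Matrix.mulVec_sub, ← WithLp.ofLp_sub]
  exact norm_transpose_mulVec_le _ _

lemma differentiable_network_left (hσ : Differentiable ℝ σ) (x : Vec din) (w : Mat d dout) :
    Differentiable ℝ fun v : Mat din d => network σ x v w := by
  rw [differentiable_euclidean]
  intro o
  simp only [network, Matrix.mulVec, dotProduct, Matrix.transpose_apply]
  refine Differentiable.fun_sum fun j _ => (hσ.comp ?_).const_mul _
  exact Differentiable.fun_sum fun i _ => (differentiable_entry i j).mul_const _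

lemma differentiable_network_right (x : Vec din) (v : Mat din d) :
    Differentiable ℝ fun w : Mat d dout => network σ x v w := by
  rw [differentiable_euclidean]
  intro o
  simp only [network, Matrix.mulVec, dotProduct, Matrix.transpose_apply]
  exact Differentiable.fun_sum fun j _ => (differentiable_entry j o).mul_const _

variable {ρ : Measure (Vec din × Vec dout)} {l : Vec dout → Vec dout → ℝ} {lam : ℝ}

lemma Setting.differentiable_loss (h : Setting ρ l σ) (y : Vec dout) :
    Differentiable ℝ fun a => l a y :=
  (h.loss_contDiff.differentiable one_ne_zero).comp
    (differentiable_id.prodMk (differentiable_const y))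

lemma Setting.abs_loss_sub_le (h : Setting ρ l σ) (a a' y : Vec dout) :
    |l a y - l a' y| ≤ ‖a - a'‖ := by
  simpa using h.loss_lipschitz a a' y y

/-- The average loss over a batch, without the regularization. -/
noncomputable def dataLoss (l : Vec dout → Vec dout → ℝ) (σ : ℝ → ℝ)
    (z : Fin k → Vec din × Vec dout) (v : Mat din d) (w : Mat d dout) : ℝ :=
  1 / (k : ℝ) * ∑ i, l (network σ (z i).1 v w) (z i).2

lemma batchLoss_eq (hk : 1 ≤ k) (z : Fin k → Vec din × Vec dout) (v : Mat din d)
    (w : Mat d dout) :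
    batchLoss l σ lam z v w =
      dataLoss l σ z v w + lam / 2 * (frobNorm v ^ 2 + frobNorm w ^ 2) := by
  have hk' : (k : ℝ) ≠ 0 := by positivity
  simp only [batchLoss, dataLoss, regLoss, Finset.sum_add_distrib, Finset.sum_const,
    Finset.card_univ, Fintype.card_fin, nsmul_eq_mul]
  field_simp

lemma abs_average_sub_le (hk : 1 ≤ k) {f g : Fin k → ℝ} {C : ℝ} (h : ∀ i, |f i - g i| ≤ C) :
    |1 / (k : ℝ) * ∑ i, f i - 1 / (k : ℝ) * ∑ i, g i| ≤ C := by
  have hk' : (0 : ℝ) < k := by positivity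
  rw [← mul_sub, ← Finset.sum_sub_distrib, abs_mul, abs_of_pos (by positivity)]
  have : |∑ i, (f i - g i)| ≤ k * C := (Finset.abs_sum_le_sum_abs _ _).trans
    ((Finset.sum_le_card_nsmul _ _ C fun i _ => h i).trans (by simp))
  calc _ ≤ 1 / (k : ℝ) * (k * C) := mul_le_mul_of_nonneg_left this (by positivity)
    _ = C := by field_simp

lemma matGrad_add_regularizer {m n : ℕ} {F : Mat m n → ℝ} {v : Mat m n}
    (hF : DifferentiableAt ℝ F v) (lam c : ℝ) :
    matGrad (fun v => F v + lam / 2 * (frobNorm v ^ 2 + c)) v = matGrad F v + lam • v := by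
  ext i j
  have h1 := hF.lineDifferentiableAt (v := Matrix.single i j (1 : ℝ)) |>.hasLineDerivAt
  have h2 := hasLineDerivAt_frobNorm_sq v i j
  have h3 : HasLineDerivAt ℝ (fun v => F v + lam / 2 * (frobNorm v ^ 2 + c))
      (lineDeriv ℝ F v (Matrix.single i j 1) + lam / 2 * (2 * v i j)) v (Matrix.single i j 1) :=
    HasDerivAt.add h1 (HasDerivAt.const_mul _ (HasDerivAt.add_const _ h2))
  simp only [matGrad, Matrix.of_apply, Matrix.add_apply, Matrix.smul_apply, smul_eq_mul,
    h3.lineDeriv]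
  ring

variable {z : Fin k → Vec din × Vec dout}

lemma Setting.differentiable_dataLoss_left (h : Setting ρ l σ) (w : Mat d dout) :
    Differentiable ℝ fun v : Mat din d => dataLoss l σ z v w :=
  (Differentiable.fun_sum fun i _ => (h.differentiable_loss (z i).2).comp
    (differentiable_network_left (h.act_contDiff.differentiable one_ne_zero) _ w)).const_mul _

lemma Setting.differentiable_dataLoss_right (h : Setting ρ l σ) (v : Mat din d) :
    Differentiable ℝ fun w : Mat d dout => dataLoss l σ z v w :=
  (Differentiable.fun_sum fun i _ => (h.differentiable_loss (z i).2).comp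
    (differentiable_network_right _ v)).const_mul _

lemma Setting.norm_matGrad_dataLoss_left_le (h : Setting ρ l σ) (hk : 1 ≤ k)
    (hz : ∀ i, ‖(z i).1‖ ≤ 1) (v : Mat din d) (w : Mat d dout) :
    ‖matGrad (fun v => dataLoss l σ z v w) v‖ ≤ ‖w‖ := by
  refine (l2_opNorm_le_frobNorm _).trans (frobNorm_matGrad_le
    (h.differentiable_dataLoss_left w v) (norm_nonneg _) fun v' => abs_average_sub_le hk fun i => ?_)
  refine (h.abs_loss_sub_le _ _ _).trans ((norm_network_sub_le_of_left h.act_lipschitz _ _ _ _).trans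
    (mul_le_mul_of_nonneg_right ?_ (norm_nonneg _)))
  exact mul_le_of_le_one_right (norm_nonneg _) (hz i)

lemma Setting.norm_matGrad_dataLoss_right_le (h : Setting ρ l σ) (hk : 1 ≤ k)
    (hz : ∀ i, ‖(z i).1‖ ≤ 1) (v : Mat din d) (w : Mat d dout) :
    ‖matGrad (fun w => dataLoss l σ z v w) w‖ ≤ ‖v‖ := by
  refine (l2_opNorm_le_frobNorm _).trans (frobNorm_matGrad_le
    (h.differentiable_dataLoss_right v w) (norm_nonneg _) fun w' => abs_average_sub_le hk fun i => ?_)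
  refine (h.abs_loss_sub_le _ _ _).trans ((norm_network_sub_le_of_right h.act_lipschitz h.act_zero
    _ _ _ _).trans (mul_le_mul_of_nonneg_right ?_ (norm_nonneg _)))
  exact mul_le_of_le_one_right (norm_nonneg _) (hz i)

lemma norm_decay_step_le {E : Type*} [SeminormedAddCommGroup E] [NormedSpace ℝ E] {v D : E}
    {η lam C : ℝ} (hη : 0 ≤ η) (hηlam : η * lam ≤ 1) (hD : ‖D‖ ≤ C) :
    ‖v - η • (D + lam • v)‖ ≤ (1 - η * lam) * ‖v‖ + η * C := by
  have h1 : v - η • (D + lam • v) = (1 - η * lam) • v - η • D := by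
    module
  rw [h1]
  refine (norm_sub_le _ _).trans ?_
  rw [norm_smul, norm_smul, Real.norm_of_nonneg (sub_nonneg.2 hηlam), Real.norm_of_nonneg hη]
  gcongr

lemma Setting.norm_step_left_le (h : Setting ρ l σ) (hk : 1 ≤ k) (hz : ∀ i, ‖(z i).1‖ ≤ 1)
    {η : ℝ} (hη : 0 ≤ η) (hηlam : η * lam ≤ 1) (v : Mat din d) (w : Mat d dout) :
    ‖v - η • matGrad (fun v => batchLoss l σ lam z v w) v‖ ≤ (1 - η * lam) * ‖v‖ + η * ‖w‖ := by
  simp only [batchLoss_eq hk]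
  rw [matGrad_add_regularizer (h.differentiable_dataLoss_left w v)]
  exact norm_decay_step_le hη hηlam (h.norm_matGrad_dataLoss_left_le hk hz v w)

lemma Setting.norm_step_right_le (h : Setting ρ l σ) (hk : 1 ≤ k) (hz : ∀ i, ‖(z i).1‖ ≤ 1)
    {η : ℝ} (hη : 0 ≤ η) (hηlam : η * lam ≤ 1) (v : Mat din d) (w : Mat d dout) :
    ‖w - η • matGrad (fun w => batchLoss l σ lam z v w) w‖ ≤ (1 - η * lam) * ‖w‖ + η * ‖v‖ := by
  simp only [batchLoss_eq hk, add_comm (frobNorm v ^ 2)]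
  rw [matGrad_add_regularizer (h.differentiable_dataLoss_right v w)]
  exact norm_decay_step_le hη hηlam (h.norm_matGrad_dataLoss_right_le hk hz v w)

lemma Setting.supGrad_le (h : Setting ρ l σ) (v : Mat din d) (w : Mat d dout) :
    supGrad ρ l σ lam v w ≤ ENNReal.ofReal (‖v‖ * ‖w‖) := by
  refine iSup₂_le fun q _ => ENNReal.ofReal_le_ofReal ?_
  rw [gradient, LinearIsometryEquiv.norm_map]
  -- The Lipschitz estimate alone bounds `fderiv`; the regularizer does not depend on `x` and
  -- cancels.
  refine norm_fderiv_le_of_lip' ℝ (by positivity) (Filter.Eventually.of_forall fun x => ?_)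
  simp only [regLoss, add_sub_add_right_eq_sub, Real.norm_eq_abs]
  exact (h.abs_loss_sub_le _ _ _).trans (norm_network_sub_le_of_input h.act_lipschitz _ _ _ _)

variable {ηV ηW : ℕ → ℝ} {Z : ℕ → Fin k → Vec din × Vec dout} {T : ℕ}

lemma sgm_snd_eq_of_frozen (hηW : ∀ t < T, ηW t = 0) (v₀ : Mat din d) (w₀ : Mat d dout) :
    ∀ t ≤ T, (sgm l σ lam ηV ηW Z v₀ w₀ t).2 = w₀ := by
  intro t ht
  induction t with
  | zero => rfl
  | succ t ih => simp [sgm, hηW t ht, ih (Nat.le_of_succ_le ht)]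

/-- The affine map `a ↦ (1 - ηλ)a + η‖w₀‖` fixes `‖w₀‖/λ` for every `η`, so the bound is a convex
combination of `‖v₀‖` and this fixed point. -/
lemma Setting.norm_sgm_fst_le (h : Setting ρ l σ) (hk : 1 ≤ k) (hlam : 0 < lam)
    (hηV : ∀ t < T, 0 ≤ ηV t ∧ ηV t * lam ≤ 1) (hηW : ∀ t < T, ηW t = 0)
    (hZ : ∀ t < T, ∀ i, ‖(Z t i).1‖ ≤ 1) (v₀ : Mat din d) (w₀ : Mat d dout) :
    ∀ t ≤ T, ‖(sgm l σ lam ηV ηW Z v₀ w₀ t).1‖ ≤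
      (∏ s ∈ Finset.range t, (1 - ηV s * lam)) * ‖v₀‖ +
        ‖w₀‖ / lam * (1 - ∏ s ∈ Finset.range t, (1 - ηV s * lam)) := by
  intro t ht
  induction t with
  | zero => simp [sgm]
  | succ t ih =>
    have h1 := h.norm_step_left_le hk (hZ t ht) (hηV t ht).1 (hηV t ht).2
      (sgm l σ lam ηV ηW Z v₀ w₀ t).1 (sgm l σ lam ηV ηW Z v₀ w₀ t).2
    rw [sgm_snd_eq_of_frozen hηW v₀ w₀ t (Nat.le_of_succ_le ht)] at h1
    have h2 := mul_le_mul_of_nonneg_left (ih (Nat.le_of_succ_le ht))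
      (sub_nonneg.2 (hηV t ht).2)
    simp only [sgm, sgm_snd_eq_of_frozen hηW v₀ w₀ t (Nat.le_of_succ_le ht)]
    refine h1.trans ((add_le_add h2 le_rfl).trans_eq ?_)
    rw [Finset.prod_range_succ]
    field_simp
    ring

/-- With equal rates, adding the two step bounds closes the recursion: the sum is multiplied by `(1
- ηλ) + η`. -/
lemma Setting.norm_sgm_add_norm_sgm_le (h : Setting ρ l σ) (hk : 1 ≤ k)
    (hηV : ∀ t < T, 0 ≤ ηV t ∧ ηV t * lam ≤ 1) (hηW : ∀ t < T, ηW t = ηV t)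
    (hZ : ∀ t < T, ∀ i, ‖(Z t i).1‖ ≤ 1) (v₀ : Mat din d) (w₀ : Mat d dout) :
    ∀ t ≤ T, ‖(sgm l σ lam ηV ηW Z v₀ w₀ t).1‖ + ‖(sgm l σ lam ηV ηW Z v₀ w₀ t).2‖ ≤
      (∏ s ∈ Finset.range t, (1 + (1 - lam) * ηV s)) * (‖v₀‖ + ‖w₀‖) := by
  intro t ht
  induction t with
  | zero => simp [sgm]
  | succ t ih =>
    obtain ⟨h0, h1⟩ := hηV t ht
    have h2 := h.norm_step_left_le hk (hZ t ht) h0 h1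
      (sgm l σ lam ηV ηW Z v₀ w₀ t).1 (sgm l σ lam ηV ηW Z v₀ w₀ t).2
    have h3 := h.norm_step_right_le hk (hZ t ht) h0 h1
      (sgm l σ lam ηV ηW Z v₀ w₀ t).1 (sgm l σ lam ηV ηW Z v₀ w₀ t).2
    have h4 := mul_le_mul_of_nonneg_left (ih (Nat.le_of_succ_le ht))
      (show 0 ≤ 1 + (1 - lam) * ηV t by nlinarith)
    simp only [sgm, hηW t ht]
    rw [Finset.prod_range_succ]
    linarith

end Network

/-! ### Probability bookkeeping and the final constants. -/

section Assembly

variable {Ω : Type*} [MeasurableSpace Ω] {μ : Measure Ω}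

/-- Only subadditivity is used, so `B` need not be measurable. -/
lemma ofReal_one_sub_le_of_measure_compl_le [IsProbabilityMeasure μ] {A B : Set Ω} {ζ : ℝ}
    (hζ : 0 ≤ ζ) (hA : μ A ≤ ENNReal.ofReal ζ) (h : ∀ᵐ ω ∂μ, ω ∉ A → ω ∈ B) :
    ENNReal.ofReal (1 - ζ) ≤ μ B := by
  have h1 : μ Set.univ ≤ μ (B ∪ A) := measure_mono_ae <| by
    filter_upwards [h] with ω hω _
    by_cases hωA : ω ∈ A
    exacts [Or.inr hωA, Or.inl (hω hωA)]
  rw [ENNReal.ofReal_sub _ hζ, ENNReal.ofReal_one, tsub_le_iff_right, ← measure_univ (μ := μ)]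
  exact h1.trans ((measure_union_le _ _).trans (add_le_add le_rfl hA))

lemma Setting.ae_norm_fst_le_one {din dout k T : ℕ} {ρ : Measure (Vec din × Vec dout)}
    {l : Vec dout → Vec dout → ℝ} {σ : ℝ → ℝ} (h : Setting ρ l σ)
    {Z : ℕ → Fin k → Ω → Vec din × Vec dout} (hZ : ∀ t < T, ∀ i, HasLaw (Z t i) ρ μ) :
    ∀ᵐ ω ∂μ, ∀ t < T, ∀ i, ‖(Z t i ω).1‖ ≤ 1 := by
  refine ae_all_iff.2 fun t => ?_
  by_cases ht : t < T
  · have : ∀ i, ∀ᵐ ω ∂μ, ‖(Z t i ω).1‖ ≤ 1 := fun i => by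
      have h1 : ∀ᵐ z ∂(μ.map (Z t i)), z ∈ ρ.support := by
        rw [(hZ t ht i).map_eq]
        exact Measure.support_mem_ae
      filter_upwards [ae_of_ae_map (hZ t ht i).aemeasurable h1] with ω hω
      exact (le_max_left _ _).trans (h.support_subset hω)
    filter_upwards [ae_all_iff.2 this] with ω hω _
    exact hω
  · exact ae_of_all _ fun _ h => absurd h ht

lemma exp_neg_sq_sqrt_two_log {c : ℝ} (hc : 1 < c) :
    Real.exp (-√(2 * Real.log c) ^ 2 / 2) = c⁻¹ := by
  have h := Real.log_pos hc
  rw [Real.sq_sqrt (by positivity), show -(2 * Real.log c) / 2 = -Real.log c by ring,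
    Real.exp_neg, Real.exp_log (by linarith)]

/-- The bound on `(‖V(0)‖ + ‖W(0)‖)² / 4` by the Cauchy–Schwarz inequality. -/
lemma sq_add_norm_bounds_le {p q r t κ : ℝ} (hp : 0 ≤ p) (hq : 0 < q) (hr : 0 < r) (hκ : 0 ≤ κ) :
    ((√p + √q + t) * √(κ / q) + (√q + √r + t) * √(κ / r)) ^ 2 / 4 ≤
      3 * κ * (2 + p / q + q / r + (1 / q + 1 / r) * t ^ 2) := by
  have hA : 0 ≤ p / q := by positivity
  have hB : 0 ≤ q / r := by positivity
  obtain ⟨P, hP⟩ : ∃ P, P = √p := ⟨_, rfl⟩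
  obtain ⟨Q, hQ⟩ : ∃ Q, Q = √q := ⟨_, rfl⟩
  obtain ⟨R, hR⟩ : ∃ R, R = √r := ⟨_, rfl⟩
  obtain ⟨K, hK⟩ : ∃ K, K = √κ := ⟨_, rfl⟩
  have hQ0 : 0 < Q := hQ ▸ Real.sqrt_pos.2 hq
  have hR0 : 0 < R := hR ▸ Real.sqrt_pos.2 hr
  rw [Real.sqrt_div hκ, Real.sqrt_div hκ, ← hP, ← hQ, ← hR, ← hK,
    show p = P ^ 2 by rw [hP, Real.sq_sqrt hp], show q = Q ^ 2 by rw [hQ, Real.sq_sqrt hq.le],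
    show r = R ^ 2 by rw [hR, Real.sq_sqrt hr.le], show κ = K ^ 2 by rw [hK, Real.sq_sqrt hκ]]
  -- Cauchy–Schwarz on six terms gives the constant `6/4`, which is at most 3.
  have key : ∀ a b c e : ℝ, (a + 1 + b + (c + 1 + e)) ^ 2 / 4 ≤
      3 * (2 + a ^ 2 + c ^ 2 + (b ^ 2 + e ^ 2)) := fun a b c e => by
    have h := sq_sum_le_card_mul_sum_sq (s := (Finset.univ : Finset (Fin 6)))
      (f := ![a, 1, b, c, 1, e])
    simp [Fin.sum_univ_succ] at h
    nlinarith [sq_nonneg a, sq_nonneg b, sq_nonneg c, sq_nonneg e]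
  have h := mul_le_mul_of_nonneg_left (key (P / Q) (t / Q) (Q / R) (t / R)) (sq_nonneg K)
  calc _ = K ^ 2 * ((P / Q + 1 + t / Q + (Q / R + 1 + t / R)) ^ 2 / 4) := by
        field_simp
    _ ≤ _ := h
    _ = _ := by field_simp

end Assembly

end TwoLayer

theorem mainTheorem7
    {Ω : Type*} [MeasurableSpace Ω] (μ : Measure Ω) [IsProbabilityMeasure μ]
    {din d dout k : ℕ} (hdin : 1 ≤ din) (hd : 1 ≤ d) (hdout : 1 ≤ dout) (hk : 1 ≤ k)
    (T : ℕ) (lam κ : ℝ) (hlam : 0 < lam) (hκ : 0 < κ)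
    (ρ : Measure (TwoLayer.Vec din × TwoLayer.Vec dout)) [IsProbabilityMeasure ρ]
    (l : TwoLayer.Vec dout → TwoLayer.Vec dout → ℝ) (σ : ℝ → ℝ)
    (hset : TwoLayer.Setting ρ l σ)
    -- the learning rates
    (ηV ηW : ℕ → ℝ) (hη : ∀ t < T, 0 ≤ ηW t ∧ ηW t ≤ ηV t ∧ ηV t ≤ 1 / lam)
    -- the training batches: at each time, `k` independent samples with law `ρ`
    (Z : ℕ → Fin k → Ω → TwoLayer.Vec din × TwoLayer.Vec dout)
    (hZlaw : ∀ t < T, ∀ i, HasLaw (Z t i) ρ μ)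
    (hZindep : ∀ t < T, iIndepFun (Z t) μ)
    -- the initialization `V(0)`
    (V₀ : Ω → TwoLayer.Mat din d)
    (hV₀ : TwoLayer.GaussianEntries μ V₀ (κ / d))
    (hV₀indep : iIndepFun (TwoLayer.entries V₀) μ) :
    -- (a) the second layer is frozen at `w`: a fixed matrix (when `w` is a constant function)
    -- or an arbitrary random matrix, for instance a Gaussian one
    ((∀ t < T, ηW t = 0) →
      ∀ w : Ω → TwoLayer.Mat d dout, (∀ i j, AEMeasurable (fun ω => w ω i j) μ) →
      ∀ ζ : ℝ, 0 < ζ → ζ < 1 →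
        ENNReal.ofReal (1 - ζ) ≤
          μ {ω | TwoLayer.supGrad ρ l σ lam
              (TwoLayer.sgm l σ lam ηV ηW (fun t i => Z t i ω) (V₀ ω) (w ω) T).1 (w ω) ≤
            ENNReal.ofReal
              (TwoLayer.frobNorm (w ω) *
                  (√(din : ℝ) + √(d : ℝ) + √(2 * Real.log (2 / ζ))) * √(κ / d) *
                  ∏ t ∈ Finset.range T, (1 - ηV t * lam) +
                TwoLayer.frobNorm (w ω) ^ 2 / lam *
                  (1 - ∏ t ∈ Finset.range T, (1 - ηV t * lam)))}) ∧
    -- (b) equal learning rates, with both layers trained from a Gaussian initialization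
    ((∀ t < T, ηW t = ηV t) →
      ∀ W₀ : Ω → TwoLayer.Mat d dout, TwoLayer.GaussianEntries μ W₀ (κ / dout) →
      iIndepFun (Sum.elim (TwoLayer.entries V₀) (TwoLayer.entries W₀)) μ →
      ∀ ζ : ℝ, 0 < ζ → ζ < 1 →
        ENNReal.ofReal (1 - ζ) ≤
          μ {ω | TwoLayer.supGrad ρ l σ lam
              (TwoLayer.sgm l σ lam ηV ηW (fun t i => Z t i ω) (V₀ ω) (W₀ ω) T).1
              (TwoLayer.sgm l σ lam ηV ηW (fun t i => Z t i ω) (V₀ ω) (W₀ ω) T).2 ≤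
            ENNReal.ofReal
              (3 * κ * (2 + (din : ℝ) / d + (d : ℝ) / dout +
                  (2 / (d : ℝ) + 2 / (dout : ℝ)) * Real.log (4 / ζ)) *
                ∏ t ∈ Finset.range T, (1 + (1 - lam) * ηV t) ^ 2)}) := by
  open scoped Matrix.Norms.L2Operator in
  have hd' : (0 : ℝ) < d := by exact_mod_cast hd
  have hdout' : (0 : ℝ) < dout := by exact_mod_cast hdout
  have hηV : ∀ t < T, 0 ≤ ηV t ∧ ηV t * lam ≤ 1 := fun t ht =>
    ⟨(hη t ht).1.trans (hη t ht).2.1, (le_div_iff₀ hlam).1 (hη t ht).2.2⟩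
  have hZ := hset.ae_norm_fst_le_one hZlaw
  refine ⟨fun hW w _ ζ hζ0 hζ1 => ?_, fun hW W₀ hW₀ hindep ζ hζ0 hζ1 => ?_⟩
  -- This level makes the one-sided tail equal to `ζ/2`, within the allowed `ζ`.
  · have hc : 1 < 2 / ζ := by rw [lt_div_iff₀ hζ0]; linarith
    have ht : 0 < √(2 * Real.log (2 / ζ)) :=
      Real.sqrt_pos.2 (mul_pos two_pos (Real.log_pos hc))
    have htail := TwoLayer.measure_l2_opNorm_gt_le hdin hd (div_pos hκ hd') hV₀ hV₀indep ht
    rw [TwoLayer.exp_neg_sq_sqrt_two_log hc] at htail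
    refine TwoLayer.ofReal_one_sub_le_of_measure_compl_le hζ0.le
      (htail.trans (ENNReal.ofReal_le_ofReal (by rw [inv_div]; linarith))) ?_
    filter_upwards [hZ] with ω hω hωA
    have hV : ‖V₀ ω‖ ≤ _ := not_lt.1 hωA
    have h1 := hset.norm_sgm_fst_le hk hlam hηV hW hω (V₀ ω) (w ω) T le_rfl
    refine (hset.supGrad_le _ _).trans (ENNReal.ofReal_le_ofReal ?_)
    have hP0 : 0 ≤ ∏ t ∈ Finset.range T, (1 - ηV t * lam) := Finset.prod_nonneg fun t ht =>
      sub_nonneg.2 (hηV t (Finset.mem_range.1 ht)).2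
    have hP1 : ∏ t ∈ Finset.range T, (1 - ηV t * lam) ≤ 1 := Finset.prod_le_one
      (fun t ht => sub_nonneg.2 (hηV t (Finset.mem_range.1 ht)).2)
      fun t ht => sub_le_self _ (mul_nonneg (hηV t (Finset.mem_range.1 ht)).1 hlam.le)
    set P := ∏ t ∈ Finset.range T, (1 - ηV t * lam)
    have hw := TwoLayer.l2_opNorm_le_frobNorm (w ω)
    have hw0 := TwoLayer.frobNorm_nonneg (w ω)
    calc _ ≤ (P * ((√(din : ℝ) + √(d : ℝ) + √(2 * Real.log (2 / ζ))) * √(κ / d)) +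
          TwoLayer.frobNorm (w ω) / lam * (1 - P)) * TwoLayer.frobNorm (w ω) := by
          refine mul_le_mul (h1.trans (add_le_add (mul_le_mul_of_nonneg_left hV hP0)
            (mul_le_mul_of_nonneg_right ?_ (sub_nonneg.2 hP1)))) hw (norm_nonneg _) ?_
          · exact div_le_div_of_nonneg_right hw hlam.le
          · have := sub_nonneg.2 hP1
            positivity
      _ = _ := by ring
  -- Each matrix fails with probability at most `ζ/4`; the union bound gives `ζ/2 ≤ ζ`.
  · have hc : 1 < 4 / ζ := by rw [lt_div_iff₀ hζ0]; linarith
    have ht : 0 < √(2 * Real.log (4 / ζ)) :=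
      Real.sqrt_pos.2 (mul_pos two_pos (Real.log_pos hc))
    have hW₀indep : iIndepFun (TwoLayer.entries W₀) μ := iIndepFun.precomp (g := Sum.inr)
      Sum.inr_injective hindep
    have htV := TwoLayer.measure_l2_opNorm_gt_le hdin hd (div_pos hκ hd') hV₀ hV₀indep ht
    have htW := TwoLayer.measure_l2_opNorm_gt_le hd hdout (div_pos hκ hdout') hW₀ hW₀indep ht
    rw [TwoLayer.exp_neg_sq_sqrt_two_log hc] at htV htW
    refine TwoLayer.ofReal_one_sub_le_of_measure_compl_le hζ0.le
      ((measure_union_le _ _).trans ((add_le_add htV htW).trans ?_)) ?_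
    · rw [inv_div, ← ENNReal.ofReal_add (by positivity) (by positivity)]
      exact ENNReal.ofReal_le_ofReal (by linarith)
    filter_upwards [hZ] with ω hω hωA
    rw [Set.mem_union, not_or] at hωA
    have hV : ‖V₀ ω‖ ≤ _ := not_lt.1 hωA.1
    have hW' : ‖W₀ ω‖ ≤ _ := not_lt.1 hωA.2
    have h1 := hset.norm_sgm_add_norm_sgm_le hk hηV hW hω (V₀ ω) (W₀ ω) T le_rfl
    refine (hset.supGrad_le _ _).trans (ENNReal.ofReal_le_ofReal ?_)
    have hP0 : 0 ≤ ∏ t ∈ Finset.range T, (1 + (1 - lam) * ηV t) := Finset.prod_nonneg fun t ht => by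
      have := hηV t (Finset.mem_range.1 ht)
      nlinarith
    rw [Finset.prod_pow]
    set P := ∏ t ∈ Finset.range T, (1 + (1 - lam) * ηV t)
    set t := √(2 * Real.log (4 / ζ)) with ht_def
    have ht2 : t ^ 2 = 2 * Real.log (4 / ζ) :=
      Real.sq_sqrt (mul_nonneg zero_le_two (Real.log_pos hc).le)
    have hCS := TwoLayer.sq_add_norm_bounds_le (t := t) (Nat.cast_nonneg din) hd' hdout' hκ.le
    set A := (√(din : ℝ) + √(d : ℝ) + t) * √(κ / d) + (√(d : ℝ) + √(dout : ℝ) + t) * √(κ / dout)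
    have h2 := h1.trans (mul_le_mul_of_nonneg_left (add_le_add hV hW') hP0)
    have h3 := pow_le_pow_left₀ (by positivity) h2 2
    rw [mul_pow] at h3
    calc _ ≤ A ^ 2 / 4 * P ^ 2 := by
          set a := ‖(TwoLayer.sgm l σ lam ηV ηW (fun t i => Z t i ω) (V₀ ω) (W₀ ω) T).1‖
          set b := ‖(TwoLayer.sgm l σ lam ηV ηW (fun t i => Z t i ω) (V₀ ω) (W₀ ω) T).2‖
          -- `ab ≤ (a + b)²/4` passes from the sum of the norms, which the recursion controls, to
          -- their product.
          nlinarith [sq_nonneg (a - b)]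
      _ ≤ _ := mul_le_mul_of_nonneg_right hCS (sq_nonneg P)
      _ = _ := by rw [ht2]; ring
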